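/- Let \(m\ge 0\), \(N=2m+3\), let \(A,T\in\mathbb{C}^{N\times N}\) and \(C^{+},C^-\in\mathbb{C}^N\) satisfy \[AT+TA=0,\qquad T^2=I,\qquad C^-=TC^+ .\] With \(x=t_1\) and times \(t=(t_1,t_3,t_5,\dots)\), put \[\varphi=\exp\Bigl(\tfrac12\sum_{j\ge0}A^{2j+1}t_{2j+1}\Bigr)C^+,\qquad \psi=\exp\Bigl(-\tfrac12\sum_{j\ge0}A^{2j+1}t_{2j+1}\Bigr)C^-\] at all (real or complex) \(t\) for which the series converges. Write \(|\widehat\varphi^{(a)};\widehat\psi^{(b)}|\) with \(a+b+2=N\) for the determinant with columns \(\varphi,\partial_x\varphi,\dots,\partial_x^a\varphi,\psi,\partial_x\psi,\dots,\partial_x^b\psi\) (no column from \(\psi\) if \(b=-1\)), and put \(f=|\widehat\varphi^{(m+1)};\widehat\psi^{(m)}|\), \(h=|\widehat\varphi^{(m)};\widehat\psi^{(m+1)}|\). The AKNS hierarchy is \((q,r)^T_{t_n}=K_n=(K_{1,n},K_{2,n})^T=L^n(-q,r)^T\), \(n\ge 1\), where \[L=\begin{pmatrix}-\partial_x+2q\partial_x^{-1}r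 & 2q\partial_x^{-1}q\\ -2r\partial_x^{-1}r & \partial_x-2r\partial_x^{-1}q\end{pmatrix}\] and \(\partial_x^{-1}\) gives the primitive among the differential polynomials in \(q,r\) that has no constant term. For \(\varepsilon=\pm1\), the KdV hierarchy with \(q=\varepsilon\) is \(r_{t_{2l+1}}=K_{2,2l+1}|_{q=\varepsilon}\), \(l=0,1,2,\dots\); its member \(l=1\) is \(r_{t_3}=r_{xxx}-6\varepsilon rr_x\). Then \(\det T=\pm1\), \(\psi=T\varphi\) and \(h=(\det T)f\). Moreover, wherever \(f\neq0\), the function \[r=-\frac{4\,|\widehat\varphi^{(m+2)};\widehat\psi^{(m-1)}|}{|\widehat\varphi^{(m+1)};\widehat\psi^{(m)}|}\] is holomorphic in \(x\) and satisfies all equations of the KdV hierarchy with \(q=h/f=\det T\). -/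

import Mathlib

open scoped Matrix

namespace AKNS

/-! ### Differential polynomials and the AKNS hierarchy -/

/-- Differential polynomials in two functions `q`, `r` of `x`, with complex coefficients.
The variable `Sum.inl k` stands for `∂ₓᵏ q` and `Sum.inr k` for `∂ₓᵏ r`. -/
abbrev DiffPoly : Type := MvPolynomial (ℕ ⊕ ℕ) ℂ

/-- The differential polynomial `q`. -/
noncomputable def qVar : DiffPoly := MvPolynomial.X (Sum.inl 0)

/-- The differential polynomial `r`. -/
noncomputable def rVar : DiffPoly := MvPolynomial.X (Sum.inr 0)

/-- The derivation `∂ₓ` of the ring of differential polynomials. -/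
noncomputable def dx : Derivation ℂ DiffPoly DiffPoly :=
  MvPolynomial.mkDerivation ℂ
    (Sum.elim (fun k => MvPolynomial.X (Sum.inl (k + 1)))
      (fun k => MvPolynomial.X (Sum.inr (k + 1))))

/-- `w` is the primitive of `v` under `∂ₓ`: `∂ₓ w = v`, and `w` has no constant term. -/
def IsPrimitive (v w : DiffPoly) : Prop :=
  MvPolynomial.constantCoeff w = 0 ∧ dx w = v

open scoped Classical in
/-- The operator `∂ₓ⁻¹` on differential polynomials (with the value `0` where there is no
primitive; this never occurs in the hierarchy, see `aknsK_primitive`). -/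
noncomputable def dxInv (v : DiffPoly) : DiffPoly :=
  if h : ∃ w, IsPrimitive v w then h.choose else 0

/-- The recursion operator
`L = [[-∂ₓ + 2q ∂ₓ⁻¹ r, 2q ∂ₓ⁻¹ q], [-2r ∂ₓ⁻¹ r, ∂ₓ - 2r ∂ₓ⁻¹ q]]`
applied to a column `(u, v)`; in each row the two integral terms are collected under one `∂ₓ⁻¹`. -/
noncomputable def recursionOp (u : DiffPoly × DiffPoly) : DiffPoly × DiffPoly :=
  (-dx u.1 + 2 * qVar * dxInv (rVar * u.1 + qVar * u.2),
    dx u.2 - 2 * rVar * dxInv (rVar * u.1 + qVar * u.2))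

/-- The members `K_n = L^n (-q, r)` of the AKNS hierarchy. -/
noncomputable def aknsK (n : ℕ) : DiffPoly × DiffPoly :=
  recursionOp^[n] (-qVar, rVar)

theorem dx_commute_inl (k : ℕ) (p : DiffPoly) :
    MvPolynomial.pderiv (Sum.inl (k + 1)) (dx p) =
      dx (MvPolynomial.pderiv (Sum.inl (k + 1)) p) + MvPolynomial.pderiv (Sum.inl k) p := by
  have h : (⁅(MvPolynomial.pderiv (Sum.inl (k + 1)) : Derivation ℂ DiffPoly DiffPoly), dx⁆ : Derivation ℂ DiffPoly DiffPoly) =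
      MvPolynomial.pderiv (Sum.inl k) := by
    apply MvPolynomial.derivation_ext
    rintro (i | i) <;> simp [Derivation.commutator_apply, dx, MvPolynomial.pderiv_X, Pi.single_apply,
      apply_ite]
  have h2 := congrArg (fun D => D p) h
  simp only [Derivation.commutator_apply] at h2
  rw [← h2]; ring

theorem dx_commute_inr (k : ℕ) (p : DiffPoly) :
    MvPolynomial.pderiv (Sum.inr (k + 1)) (dx p) =
      dx (MvPolynomial.pderiv (Sum.inr (k + 1)) p) + MvPolynomial.pderiv (Sum.inr k) p := by
  have h : (⁅(MvPolynomial.pderiv (Sum.inr (k + 1)) : Derivation ℂ DiffPoly DiffPoly), dx⁆ : Derivation ℂ DiffPoly DiffPoly) =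
      MvPolynomial.pderiv (Sum.inr k) := by
    apply MvPolynomial.derivation_ext
    rintro (i | i) <;> simp [Derivation.commutator_apply, dx, MvPolynomial.pderiv_X, Pi.single_apply,
      apply_ite]
  have h2 := congrArg (fun D => D p) h
  simp only [Derivation.commutator_apply] at h2
  rw [← h2]; ring

/-- A differential polynomial without constant term that is killed by `∂ₓ` is zero. -/
theorem eq_zero_of_dx_eq_zero {p : DiffPoly} (h0 : MvPolynomial.constantCoeff p = 0)
    (hp : dx p = 0) : p = 0 := by
  obtain ⟨N, hN⟩ : ∃ N : ℕ, ∀ k, N ≤ k → MvPolynomial.pderiv (Sum.inl k) p = 0 ∧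
      MvPolynomial.pderiv (Sum.inr k) p = 0 := by
    refine ⟨(p.vars.sup (Sum.elim id id)) + 1, fun k hk => ⟨?_, ?_⟩⟩ <;>
    · apply MvPolynomial.pderiv_eq_zero_of_notMem_vars
      intro hmem
      have := Finset.le_sup (f := Sum.elim id id) hmem
      simp only [Sum.elim_inl, Sum.elim_inr, id] at this
      omega
  have hall : ∀ d k, N ≤ k + d → MvPolynomial.pderiv (Sum.inl k) p = 0 ∧
      MvPolynomial.pderiv (Sum.inr k) p = 0 := by
    intro d
    induction d with
    | zero => exact fun k hk => hN k hk
    | succ d ih =>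
      intro k hk
      obtain ⟨h1, h2⟩ := ih (k + 1) (by omega)
      have e1 := dx_commute_inl k p
      have e2 := dx_commute_inr k p
      rw [hp, h1] at e1
      rw [hp, h2] at e2
      simp only [map_zero, zero_add] at e1 e2
      exact ⟨e1.symm, e2.symm⟩
  have hz : ∀ i, MvPolynomial.pderiv i p = 0 := by
    rintro (k | k)
    · exact (hall N k (by omega)).1
    · exact (hall N k (by omega)).2
  ext s
  rw [MvPolynomial.coeff_zero]
  by_cases hs : s = 0
  · subst hs; exact h0
  · obtain ⟨i, hi⟩ := Finsupp.ne_iff.mp hs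
    have hle : Finsupp.single i 1 ≤ s := by
      rw [Finsupp.single_le_iff]; exact Nat.one_le_iff_ne_zero.mpr hi
    have := MvPolynomial.coeff_pderiv (i := i) p (s - Finsupp.single i 1)
    rw [hz i, tsub_add_cancel_of_le hle, MvPolynomial.coeff_zero] at this
    have hne : (((s - Finsupp.single i 1 : ℕ ⊕ ℕ →₀ ℕ) i + 1 : ℕ) : ℂ) ≠ 0 := Nat.cast_ne_zero.mpr (by omega)
    push_cast at hne
    rcases mul_eq_zero.mp this.symm with h | h
    · exact h
    · exact absurd h hne

/-- Primitives are unique, so `∂ₓ⁻¹` takes the value of any primitive at hand. -/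
theorem IsPrimitive.dxInv_eq {v w : DiffPoly} (h : IsPrimitive v w) : dxInv v = w := by
  have hex : ∃ w, IsPrimitive v w := ⟨w, h⟩
  have hc : IsPrimitive v (dxInv v) := by
    rw [dxInv, dif_pos hex]; exact hex.choose_spec
  refine sub_eq_zero.mp (eq_zero_of_dx_eq_zero ?_ ?_)
  · rw [map_sub, hc.1, h.1, sub_zero]
  · rw [map_sub, hc.2, h.2, sub_self]

theorem constantCoeff_dx (p : DiffPoly) : MvPolynomial.constantCoeff (dx p) = 0 := by
  induction p using MvPolynomial.induction_on with
  | C a => simp [dx]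
  | add p q hp hq => rw [map_add, map_add, hp, hq, add_zero]
  | mul_X p i hp =>
    rw [Derivation.leibniz, map_add, smul_eq_mul, smul_eq_mul, map_mul, map_mul, hp]
    rcases i with i | i <;> simp [dx]

/-- Every application of `∂ₓ⁻¹` in the construction of the `K_n` is to a differential polynomial
that has a primitive; hence all `K_n` are genuine. -/
theorem aknsK_primitive (n : ℕ) :
    IsPrimitive (rVar * (aknsK n).1 + qVar * (aknsK n).2)
      (dxInv (rVar * (aknsK n).1 + qVar * (aknsK n).2)) := by
  set P : ℕ → DiffPoly := fun n => (aknsK n).1 with hP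
  set Q : ℕ → DiffPoly := fun n => (aknsK n).2 with hQ
  set w : ℕ → DiffPoly := fun n => dxInv (rVar * P n + qVar * Q n) with hw
  have hstep : ∀ n, aknsK (n + 1) = recursionOp (aknsK n) := fun n =>
    Function.iterate_succ_apply' _ _ _
  have hP0 : P 0 = -qVar := rfl
  have hQ0 : Q 0 = rVar := rfl
  have hPs : ∀ n, dx (P n) = 2 * qVar * w n - P (n + 1) := by
    intro n
    have : P (n + 1) = -dx (P n) + 2 * qVar * w n := by simp only [hP, hw, hQ, hstep, recursionOp]
    rw [this]; ring
  have hQs : ∀ n, dx (Q n) = Q (n + 1) + 2 * rVar * w n := by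
    intro n
    have : Q (n + 1) = dx (Q n) - 2 * rVar * w n := by simp only [hP, hw, hQ, hstep, recursionOp]
    rw [this]; ring
  have hPc : ∀ n, MvPolynomial.constantCoeff (P n) = 0 := by
    intro n
    cases n with
    | zero => simp [hP0, qVar]
    | succ n =>
      have : P (n + 1) = 2 * qVar * w n - dx (P n) := by rw [hPs]; ring
      rw [this, map_sub, constantCoeff_dx]
      simp [qVar]
  change IsPrimitive (rVar * P n + qVar * Q n) (w n)
  induction n using Nat.strong_induction_on with
  | _ n ih =>
    cases n with
    | zero =>
      have : IsPrimitive (rVar * P 0 + qVar * Q 0) 0 := by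
        refine ⟨map_zero _, ?_⟩
        rw [map_zero, hP0, hQ0]; ring
      simp only [hw]
      rw [this.dxInv_eq]; exact this
    | succ n =>
      have : IsPrimitive (rVar * P (n + 1) + qVar * Q (n + 1))
          (∑ i ∈ Finset.range (n + 1), (w i * w (n - i) - P i * Q (n - i))) := by
        refine ⟨?_, ?_⟩
        · rw [map_sum]
          refine Finset.sum_eq_zero fun i hi => ?_
          rw [map_sub, map_mul, map_mul, (ih i (by simpa using hi)).1, hPc i]
          ring
        · have hterm : ∀ i ∈ Finset.range (n + 1),
              dx (w i * w (n - i) - P i * Q (n - i)) =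
                (P (i + 1) * Q (n + 1 - (i + 1)) - P i * Q (n + 1 - i)) +
                  ((qVar * Q i * w (n - i) + rVar * w i * P (n - i)) -
                    (qVar * Q (n - i) * w (n - (n - i)) +
                      rVar * w (n - i) * P (n - (n - i)))) := by
            intro i hi
            have hi' : i < n + 1 := by simpa using hi
            have h1 : dx (w i) = rVar * P i + qVar * Q i := (ih i hi').2
            have h2 : dx (w (n - i)) = rVar * P (n - i) + qVar * Q (n - i) :=
              (ih (n - i) (by omega)).2
            rw [show n + 1 - (i + 1) = n - i by omega, show n - (n - i) = i by omega,
              show n + 1 - i = n - i + 1 by omega]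
            simp only [map_sub, Derivation.leibniz, smul_eq_mul]
            rw [h1, h2, hPs, hQs]
            ring
          rw [map_sum, Finset.sum_congr rfl hterm, Finset.sum_add_distrib,
            Finset.sum_range_sub (fun i => P i * Q (n + 1 - i)), Finset.sum_sub_distrib,
            Finset.sum_flip (fun i => qVar * Q i * w (n - i) + rVar * w i * P (n - i)),
            sub_self, add_zero, Nat.sub_self, Nat.sub_zero, hP0, hQ0]
          ring
      simp only [hw]
      rw [this.dxInv_eq]; exact this

/-- The value at the point `x` of a differential polynomial in the functions `q`, `r`. -/
noncomputable def evalAt (p : DiffPoly) (q r : ℂ → ℂ) (x : ℂ) : ℂ :=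
  MvPolynomial.eval
    (Sum.elim (fun k => iteratedDeriv k q x) (fun k => iteratedDeriv k r x)) p

/-! ### Functions of the times

The odd times are `t : ℕ → ℂ`, where `t j` is the time usually written `t_{2j+1}`;
in particular `t 0` is `t₁ = x`. -/

/-- The restriction of a function `u` of all the times to the line through `t` in the direction of
the `j`-th time, i.e. the function `s ↦ u (t₁, t₃, …, s, …)`. -/
def slice {E : Type*} (u : (ℕ → ℂ) → E) (j : ℕ) (t : ℕ → ℂ) : ℂ → E :=
  fun s => u (Function.update t j s)

/-- The right-hand side `K_{2l+1}^{KdV}` of the `l`-th member of the KdV hierarchy with `q = ε`: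
the second component of `K_{2l+1}`, evaluated at the constant function `q = ε` and at `r`
as a function of `x`. -/
noncomputable def kdvK (ε : ℂ) (l : ℕ) (r : ℂ → ℂ) (x : ℂ) : ℂ :=
  evalAt (aknsK (2 * l + 1)).2 (fun _ => ε) r x

/-- At the point `t`, the function `r` is holomorphic in `x` and satisfies all equations
`∂r/∂t_{2l+1} = K_{2l+1}^{KdV}`, `l = 0, 1, 2, …`, of the KdV hierarchy with `q = ε`. -/
structure SolvesKdVHierarchyAt (ε : ℂ) (r : (ℕ → ℂ) → ℂ) (t : ℕ → ℂ) : Prop where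
  analyticAt_x : AnalyticAt ℂ (slice r 0 t) (t 0)
  flow : ∀ l : ℕ, HasDerivAt (slice r l t) (kdvK ε l (slice r 0 t) (t 0)) (t l)

/-! ### Double Wronskians -/

/-- `∂ₓᵏ u` for a function `u` of the times. -/
noncomputable def xDeriv {N : ℕ} (k : ℕ) (u : (ℕ → ℂ) → Fin N → ℂ) (t : ℕ → ℂ) : Fin N → ℂ :=
  iteratedDeriv k (slice u 0 t) (t 0)

/-- The double Wronskian `W^{(a, N - a)}(φ, ψ)` of two `N`-vectors, `a ≤ N`: the determinant whose
columns are `φ, ∂ₓφ, …, ∂ₓ^{a-1}φ, ψ, ∂ₓψ, …, ∂ₓ^{N-a-1}ψ`. -/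
noncomputable def doubleWronskian {N : ℕ} (a : ℕ) (φ ψ : (ℕ → ℂ) → Fin N → ℂ) (t : ℕ → ℂ) : ℂ :=
  Matrix.det (Matrix.of fun (i j : Fin N) =>
    if (j : ℕ) < a then xDeriv j φ t i else xDeriv (j - a) ψ t i)

/-- The times at which the series `∑ⱼ A^{2j+1} t_{2j+1}` converges. -/
def convergenceSet {N : ℕ} (A : Matrix (Fin N) (Fin N) ℂ) : Set (ℕ → ℂ) :=
  {t | Summable fun j : ℕ => t j • A ^ (2 * j + 1)}

/-- The sum `∑ⱼ A^{2j+1} t_{2j+1}`. -/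
noncomputable def phase {N : ℕ} (A : Matrix (Fin N) (Fin N) ℂ) (t : ℕ → ℂ) :
    Matrix (Fin N) (Fin N) ℂ :=
  ∑' j : ℕ, t j • A ^ (2 * j + 1)

/-- `φ = exp(½ ∑ⱼ A^{2j+1} t_{2j+1}) C⁺`. -/
noncomputable def phi {N : ℕ} (A : Matrix (Fin N) (Fin N) ℂ) (Cp : Fin N → ℂ) (t : ℕ → ℂ) :
    Fin N → ℂ :=
  NormedSpace.exp ((1 / 2 : ℂ) • phase A t) *ᵥ Cp

/-- `ψ = exp(-½ ∑ⱼ A^{2j+1} t_{2j+1}) C⁻`. -/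
noncomputable def psi {N : ℕ} (A : Matrix (Fin N) (Fin N) ℂ) (Cm : Fin N → ℂ) (t : ℕ → ℂ) :
    Fin N → ℂ :=
  NormedSpace.exp (-((1 / 2 : ℂ) • phase A t)) *ᵥ Cm

end AKNS

/-! The proof is a dressing argument of Sato type. For odd n the vectors evolve linearly, φ_{t_n} =
½Aⁿφ and ψ_{t_n} = -½Aⁿψ, so f is the determinant of the m+2 vectors (A/2)ʲφ and the m+1 vectors
(-A/2)ʲψ. Where f ≠ 0 these form a basis, and A^{m+2}φ and A^{m+1}ψ have unique expansions in it.
With λ = X⁻¹, the reversed coefficients of these two relations form a matrix series W = 1 + W₁λ⁻¹ +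
⋯ such that W diag(λ^{m+2}, λ^{m+1}) annihilates (φ, ψ) when λ acts as A.

Differentiating the relations in t_n and using uniqueness of the expansions gives Sato's equation
W_{t_n} = -½(λⁿR)₋W with R = Wσ₃W⁻¹ (`sato_equation`). For n = 1 it implies a Lax equation for R in
x (`hasDerivAt_coeff_dress`). This equation, tr R = 0 and R² = 1 force the off-diagonal entries of R
to be the K_n up to constant factors (`evalAt_aknsK`); R² = 1 yields the diagonal entries without
integration, which matches the choice of ∂ₓ⁻¹. The λ⁻¹ coefficient of Sato's equation, (W₁)_{t_n} =
-½R_{n+1}, is then the flow r_{t_n} = K_{2,n}.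

By Cramer's rule the off-diagonal entries of W₁ are r and -h/f (`coeff_one_dressing_zero_one`,
`coeff_one_dressing_one_zero`). Since T anticommutes with A and interchanges φ and ψ, it
interchanges the two Krylov sequences, so h = (det T) f and q is constant
(`det_krylov_of_intertwining`). -/

namespace AKNS

/-! ### Dressing of formal power series -/

section Dressing

open PowerSeries

variable {E : Type*} [Ring E]

/-- The dressed series `W σ W⁻¹`, for a series `W` with constant coefficient `1`. -/
noncomputable def dress (W : E⟦X⟧) (σ : E) : E⟦X⟧ := W * C σ * invOfUnit W 1

theorem dress_mul {W : E⟦X⟧} (hW : constantCoeff W = 1) (σ : E) :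
    dress W σ * W = W * C σ := by
  rw [dress, mul_assoc, invOfUnit_mul W 1 (by simpa using hW), mul_one]

theorem coeff_zero_dress {W : E⟦X⟧} (hW : constantCoeff W = 1) (σ : E) :
    coeff 0 (dress W σ) = σ := by
  simp [dress, hW]

theorem dress_mul_self {W : E⟦X⟧} (hW : constantCoeff W = 1) {σ : E} (hσ : σ * σ = 1) :
    dress W σ * dress W σ = 1 := by
  have h : dress W σ * dress W σ = (dress W σ * W) * C σ * invOfUnit W 1 := by
    simp only [dress, mul_assoc]
  rw [h, dress_mul hW, mul_assoc W, ← map_mul, hσ, map_one, mul_one,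
    mul_invOfUnit W 1 (by simpa using hW)]

theorem coeff_one_dress {W : E⟦X⟧} (hW : constantCoeff W = 1) (σ : E) :
    coeff 1 (dress W σ) = coeff 1 W * σ - σ * coeff 1 W := by
  have h := congrArg (coeff 1) (dress_mul hW σ)
  rw [coeff_mul_C, coeff_mul, Finset.Nat.sum_antidiagonal_eq_sum_range_succ_mk,
    Finset.sum_range_succ, Finset.sum_range_one] at h
  simp only [Nat.sub_zero, Nat.sub_self, coeff_zero_dress hW, coeff_zero_eq_constantCoeff,
    hW, mul_one] at h
  rw [← h]; abel

/-- The part of `X⁻ⁿ R` with positive exponents. -/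
noncomputable def tail (n : ℕ) (R : E⟦X⟧) : E⟦X⟧ :=
  PowerSeries.mk fun k => if k = 0 then 0 else coeff (n + k) R

theorem constantCoeff_tail (n : ℕ) (R : E⟦X⟧) : constantCoeff (tail n R) = 0 := by
  rw [← coeff_zero_eq_constantCoeff_apply]; simp [tail]

theorem tail_zero (R : E⟦X⟧) : tail 0 R = R - C (coeff 0 R) := by
  ext k
  rcases k with _ | k <;> simp [tail]

/-- Passing from n to n + 1 multiplies by λ = X⁻¹ and drops the constant term that appears. All
inductions on n rest on this. -/
theorem tail_eq_X_mul (n : ℕ) (R : E⟦X⟧) :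
    tail n R = X * (tail (n + 1) R + C (coeff (n + 1) R)) := by
  ext k
  rcases k with _ | k
  · simp [tail]
  · rw [coeff_succ_X_mul]
    rcases k with _ | k
    · simp [tail]
    · simp [tail, show n + (k + 1 + 1) = n + 1 + (k + 1) by ring]

theorem coeff_tail_mul_succ (n l : ℕ) (R W : E⟦X⟧) :
    coeff l (tail (n + 1) R * W) =
      coeff (l + 1) (tail n R * W) - coeff (n + 1) R * coeff l W := by
  rw [tail_eq_X_mul n R, mul_assoc, coeff_succ_X_mul, add_mul, map_add, coeff_C_mul]
  abel

/-- Turns Sato's equation into the derivative of the first coefficient of W. -/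
theorem coeff_one_tail_mul {n : ℕ} {R W : E⟦X⟧} (hW : constantCoeff W = 1) :
    coeff 1 (tail n R * W) = coeff (n + 1) R := by
  have h := coeff_tail_mul_succ n 0 R W
  rw [coeff_zero_eq_constantCoeff_apply, coeff_zero_eq_constantCoeff_apply, map_mul,
    constantCoeff_tail, zero_mul, hW, mul_one] at h
  exact (sub_eq_zero.mp h.symm)

theorem tail_zero_dress_mul {W : E⟦X⟧} (hW : constantCoeff W = 1) (σ : E) :
    tail 0 (dress W σ) * W = W * C σ - C σ * W := by
  rw [tail_zero, coeff_zero_dress hW, sub_mul, dress_mul hW]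

end Dressing

/-! ### Curves of power series and the Lax equation -/

section DressingDeriv

open PowerSeries

variable {E : Type*} [NormedRing E] [NormedAlgebra ℂ E]

/-- Coefficientwise differentiability of a curve of power series. -/
def HasCoeffDerivAt (F : ℂ → E⟦X⟧) (F' : E⟦X⟧) (s : ℂ) : Prop :=
  ∀ k, HasDerivAt (fun s => coeff k (F s)) (coeff k F') s

theorem HasCoeffDerivAt.mul {F G : ℂ → E⟦X⟧} {F' G' : E⟦X⟧} {s : ℂ}
    (hF : HasCoeffDerivAt F F' s) (hG : HasCoeffDerivAt G G' s) :
    HasCoeffDerivAt (fun s => F s * G s) (F' * G s + F s * G') s := by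
  intro k
  simp only [map_add, coeff_mul, ← Finset.sum_add_distrib]
  exact HasDerivAt.fun_sum fun p _ => (hF p.1).mul (hG p.2)

theorem hasCoeffDerivAt_const (c : E⟦X⟧) (s : ℂ) : HasCoeffDerivAt (fun _ => c) 0 s := by
  intro k
  simpa using hasDerivAt_const s (coeff k c)

theorem HasCoeffDerivAt.unique {F : ℂ → E⟦X⟧} {F₁ F₂ : E⟦X⟧} {s : ℂ}
    (h₁ : HasCoeffDerivAt F F₁ s) (h₂ : HasCoeffDerivAt F F₂ s) : F₁ = F₂ := by
  ext k
  exact (h₁ k).unique (h₂ k)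

/-- Comparing coefficients in RW = Wσ expresses R_k through W and the lower R_j, so the inverse
series need not be differentiated. -/
theorem differentiableAt_coeff_dress {W : ℂ → E⟦X⟧} {W' : E⟦X⟧} {s : ℂ} (σ : E)
    (hW : ∀ s, constantCoeff (W s) = 1) (h : HasCoeffDerivAt W W' s) (k : ℕ) :
    DifferentiableAt ℂ (fun s => coeff k (dress (W s) σ)) s := by
  induction k using Nat.strong_induction_on with
  | _ k ih =>
    have e : ∀ s, coeff k (dress (W s) σ) = coeff k (W s) * σ -
        ∑ j ∈ Finset.range k, coeff j (dress (W s) σ) * coeff (k - j) (W s) := by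
      intro s
      have h := congrArg (coeff k) (dress_mul (hW s) σ)
      rw [coeff_mul_C, coeff_mul, Finset.Nat.sum_antidiagonal_eq_sum_range_succ_mk,
        Finset.sum_range_succ] at h
      simp only [Nat.sub_self, coeff_zero_eq_constantCoeff, hW, mul_one] at h
      rw [← h]; abel
    simp only [e]
    refine DifferentiableAt.sub ((h k).differentiableAt.mul_const σ) ?_
    refine DifferentiableAt.fun_sum fun j hj => ?_
    exact (ih j (Finset.mem_range.mp hj)).mul (h (k - j)).differentiableAt

/-- If `W' = -½ S W`, where `S` is the tail of order one of `R = W σ W⁻¹`,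
then `R` satisfies the Lax equation `R_k' = ½[σ, R_{k+1}] + ½[R₁, R_k]`. -/
theorem hasDerivAt_coeff_dress {W : ℂ → E⟦X⟧} {s : ℂ} (σ : E)
    (hW : ∀ s, constantCoeff (W s) = 1)
    (h : HasCoeffDerivAt W (-((1 / 2 : ℂ) • (tail 1 (dress (W s) σ) * W s))) s) (k : ℕ) :
    HasDerivAt (fun s => coeff k (dress (W s) σ))
      ((1 / 2 : ℂ) • ((σ * coeff (k + 1) (dress (W s) σ) - coeff (k + 1) (dress (W s) σ) * σ) +
        (coeff 1 (dress (W s) σ) * coeff k (dress (W s) σ) -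
          coeff k (dress (W s) σ) * coeff 1 (dress (W s) σ)))) s := by
  set R := dress (W s) σ with hR
  set S := tail 1 R with hS
  let R' : E⟦X⟧ := PowerSeries.mk fun k => deriv (fun s => coeff k (dress (W s) σ)) s
  have hR' : HasCoeffDerivAt (fun s => dress (W s) σ) R' s := by
    intro k
    simpa [R'] using (differentiableAt_coeff_dress σ hW h k).hasDerivAt
  have h1 := hR'.mul h
  have h2 := h.mul (hasCoeffDerivAt_const (C σ) s)
  simp only [dress_mul (hW _)] at h1
  -- Both sides of RW = Wσ are differentiated; with Wσ = RW once more, this is solved for R' = ½[R,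
  -- S].
  have h3 := h1.unique h2
  rw [← hR] at h3
  have h4 : R' * W s = ((1 / 2 : ℂ) • (R * S - S * R)) * W s := by
    have e : S * R * W s = S * W s * C σ := by
      rw [mul_assoc, mul_assoc, hR, dress_mul (hW s)]
    rw [smul_mul_assoc, sub_mul, smul_sub, e]
    rw [mul_zero, add_zero, mul_neg, neg_mul, mul_smul_comm, smul_mul_assoc] at h3
    rw [mul_assoc R]
    rw [eq_sub_iff_add_eq, ← sub_eq_zero]
    rw [← sub_eq_zero] at h3
    rw [← h3]; abel
  have h5 : R' = (1 / 2 : ℂ) • (R * S - S * R) := by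
    have hu : W s * invOfUnit (W s) 1 = 1 := mul_invOfUnit (W s) 1 (by simpa using hW s)
    have := congrArg (· * invOfUnit (W s) 1) h4
    simpa only [mul_assoc, hu, mul_one] using this
  -- Since S = λ(R - σ) - R₁ and R commutes with itself, [R, S] = λ[σ, R] + [R₁, R]; no higher
  -- coefficients remain.
  have h6 : tail 0 R = X * (S + C (coeff 1 R)) := tail_eq_X_mul 0 R
  rw [tail_zero, hR, coeff_zero_dress (hW s), ← hR] at h6
  have h7 : coeff (k + 1) (R * (R - C σ) - (R - C σ) * R) =
      coeff k (R * (S + C (coeff 1 R)) - (S + C (coeff 1 R)) * R) := by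
    have e : R * (R - C σ) - (R - C σ) * R =
        X * (R * (S + C (coeff 1 R)) - (S + C (coeff 1 R)) * R) := by
      rw [h6, mul_sub, ← mul_assoc X R, ← (commute_X R).eq, mul_assoc, mul_assoc]
    rw [e, coeff_succ_X_mul]
  have h8 := hR' k
  rw [h5] at h8
  convert h8 using 1
  rw [coeff_smul]
  congr 1
  simp only [mul_sub, sub_mul, mul_add, add_mul, map_sub, map_add, coeff_mul_C, coeff_C_mul] at h7 ⊢
  rw [← sub_eq_zero] at h7 ⊢
  rw [← h7]
  abel

end DressingDeriv

/-! ### Evaluation of the hierarchy on functions -/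

section Evaluation

open MvPolynomial

theorem hasDerivAt_evalAt {q r : ℂ → ℂ} {x : ℂ}
    (hq : ∀ k, DifferentiableAt ℂ (iteratedDeriv k q) x)
    (hr : ∀ k, DifferentiableAt ℂ (iteratedDeriv k r) x) (p : DiffPoly) :
    HasDerivAt (fun y => evalAt p q r y) (evalAt (dx p) q r x) x := by
  induction p using MvPolynomial.induction_on with
  | C a => simpa [evalAt, dx] using hasDerivAt_const x a
  | add p₁ p₂ h₁ h₂ =>
    simp only [evalAt, map_add] at h₁ h₂ ⊢
    exact h₁.fun_add h₂
  | mul_X p i h =>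
    have hX : HasDerivAt (fun y => evalAt (X i) q r y) (evalAt (dx (X i)) q r x) x := by
      rcases i with i | i
      · simpa [evalAt, dx, iteratedDeriv_succ] using (hq i).hasDerivAt
      · simpa [evalAt, dx, iteratedDeriv_succ] using (hr i).hasDerivAt
    simp only [evalAt, map_mul, Derivation.leibniz, smul_eq_mul, map_add] at h hX ⊢
    refine (h.fun_mul hX).congr_deriv ?_
    ring

theorem aknsK_succ (n : ℕ) : aknsK (n + 1) = recursionOp (aknsK n) :=
  Function.iterate_succ_apply' _ _ _

/-- The integral term `∂ₓ⁻¹ (r u + q v)` for `(u, v) = K_n`. -/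
noncomputable def aknsW (n : ℕ) : DiffPoly :=
  dxInv (rVar * (aknsK n).1 + qVar * (aknsK n).2)

theorem aknsK_fst_succ (n : ℕ) :
    (aknsK (n + 1)).1 = -dx (aknsK n).1 + 2 * qVar * aknsW n := by
  rw [aknsK_succ]; rfl

theorem aknsK_snd_succ (n : ℕ) :
    (aknsK (n + 1)).2 = dx (aknsK n).2 - 2 * rVar * aknsW n := by
  rw [aknsK_succ]; rfl

theorem aknsW_isPrimitive (n : ℕ) :
    IsPrimitive (rVar * (aknsK n).1 + qVar * (aknsK n).2) (aknsW n) := aknsK_primitive n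

theorem aknsW_zero : aknsW 0 = 0 := by
  refine IsPrimitive.dxInv_eq ⟨map_zero _, ?_⟩
  change dx 0 = rVar * -qVar + qVar * rVar
  rw [map_zero]; ring

theorem constantCoeff_aknsK_fst (n : ℕ) : constantCoeff (aknsK n).1 = 0 := by
  cases n with
  | zero => simp [aknsK, qVar]
  | succ n =>
    rw [aknsK_fst_succ, map_add, map_neg, constantCoeff_dx]
    simp [qVar]

/-- This is a coefficient of R² = 1 in disguise. It presents the integral term as a polynomial in
earlier data, so that it can be evaluated on functions without fixing a constant of integration. -/
theorem aknsW_succ (n : ℕ) : aknsW (n + 1) =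
    ∑ i ∈ Finset.range (n + 1), (aknsW i * aknsW (n - i) - (aknsK i).1 * (aknsK (n - i)).2) := by
  refine IsPrimitive.dxInv_eq ⟨?_, ?_⟩
  · rw [map_sum]
    refine Finset.sum_eq_zero fun i _ => ?_
    rw [map_sub, map_mul, map_mul, (aknsW_isPrimitive i).1, constantCoeff_aknsK_fst]
    ring
  · have hPs : ∀ n, dx (aknsK n).1 = 2 * qVar * aknsW n - (aknsK (n + 1)).1 := by
      intro n; rw [aknsK_fst_succ]; ring
    have hQs : ∀ n, dx (aknsK n).2 = (aknsK (n + 1)).2 + 2 * rVar * aknsW n := by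
      intro n; rw [aknsK_snd_succ]; ring
    -- The derivative of each summand is a telescoping difference plus a part that is antisymmetric
    -- under i ↦ n - i and cancels in the sum.
    have hterm : ∀ i ∈ Finset.range (n + 1),
        dx (aknsW i * aknsW (n - i) - (aknsK i).1 * (aknsK (n - i)).2) =
          ((aknsK (i + 1)).1 * (aknsK (n + 1 - (i + 1))).2 -
              (aknsK i).1 * (aknsK (n + 1 - i)).2) +
            ((qVar * (aknsK i).2 * aknsW (n - i) + rVar * aknsW i * (aknsK (n - i)).1) -
              (qVar * (aknsK (n - i)).2 * aknsW (n - (n - i)) +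
                rVar * aknsW (n - i) * (aknsK (n - (n - i))).1)) := by
      intro i hi
      have hi' : i < n + 1 := by simpa using hi
      rw [show n + 1 - (i + 1) = n - i by omega, show n - (n - i) = i by omega,
        show n + 1 - i = n - i + 1 by omega]
      simp only [map_sub, Derivation.leibniz, smul_eq_mul]
      rw [(aknsW_isPrimitive i).2, (aknsW_isPrimitive (n - i)).2, hPs, hQs]
      ring
    rw [map_sum, Finset.sum_congr rfl hterm, Finset.sum_add_distrib,
      Finset.sum_range_sub (fun i => (aknsK i).1 * (aknsK (n + 1 - i)).2),
      Finset.sum_sub_distrib,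
      Finset.sum_flip (fun i => qVar * (aknsK i).2 * aknsW (n - i) +
        rVar * aknsW i * (aknsK (n - i)).1),
      sub_self, add_zero, Nat.sub_self, Nat.sub_zero]
    change _ - -qVar * _ = _ + _ * _
    change _ * rVar - _ = _
    ring

/-- If the entries `a`, `b`, `c` of a resolvent satisfy the Lax recursion and the normalization
`a² + b c = 1`, coefficient by coefficient, they evaluate the members of the AKNS hierarchy. -/
theorem evalAt_aknsK {U : Set ℂ} (hU : IsOpen U) {q r : ℂ → ℂ}
    (hq : ∀ x ∈ U, ∀ k, DifferentiableAt ℂ (iteratedDeriv k q) x)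
    (hr : ∀ x ∈ U, ∀ k, DifferentiableAt ℂ (iteratedDeriv k r) x)
    {a b c : ℕ → ℂ → ℂ}
    (ha₁ : ∀ x ∈ U, a 1 x = 0)
    (hb₁ : ∀ x ∈ U, b 1 x = -2 * r x) (hc₁ : ∀ x ∈ U, c 1 x = -2 * q x)
    (hb : ∀ x ∈ U, ∀ k, HasDerivAt (b k) (b (k + 1) x + 2 * r x * a k x) x)
    (hc : ∀ x ∈ U, ∀ k, HasDerivAt (c k) (-c (k + 1) x - 2 * q x * a k x) x)
    (hsq : ∀ x ∈ U, ∀ n, 2 * a (n + 2) x + ∑ i ∈ Finset.range (n + 1),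
      (a (i + 1) x * a (n - i + 1) x + c (i + 1) x * b (n - i + 1) x) = 0)
    (n : ℕ) {x : ℂ} (hx : x ∈ U) :
    evalAt (aknsK n).1 q r x = c (n + 1) x / 2 ∧ evalAt (aknsK n).2 q r x = -(b (n + 1) x / 2) ∧
      evalAt (aknsW n) q r x = -(a (n + 1) x / 2) := by
  induction n using Nat.strong_induction_on generalizing x with
  | _ n ih =>
    cases n with
    | zero =>
      refine ⟨?_, ?_, ?_⟩
      · simp only [aknsK, Function.iterate_zero, id, evalAt, qVar, zero_add, hc₁ x hx]
        simp; ring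
      · simp only [aknsK, Function.iterate_zero, id, evalAt, rVar, zero_add, hb₁ x hx]
        simp; ring
      · simp [aknsW_zero, evalAt, ha₁ x hx]
    | succ n =>
      have hev : evalAt qVar q r x = q x ∧ evalAt rVar q r x = r x := by
        simp [evalAt, qVar, rVar]
      have hnhds : U ∈ nhds x := hU.mem_nhds hx
      refine ⟨?_, ?_, ?_⟩
      · have h1 := hasDerivAt_evalAt (hq x hx) (hr x hx) (aknsK n).1
        have h2 : HasDerivAt (fun y => evalAt (aknsK n).1 q r y)
            ((-c (n + 1 + 1) x - 2 * q x * a (n + 1) x) / 2) x := by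
          refine ((hc x hx (n + 1)).div_const 2).congr_of_eventuallyEq ?_
          filter_upwards [hnhds] with y hy using (ih n (by omega) hy).1
        have h3 := h1.unique h2
        have h4 := (ih n (by omega) hx).2.2
        rw [aknsK_fst_succ]
        simp only [evalAt, map_add, map_neg, map_mul, map_ofNat] at h3 h4 hev ⊢
        rw [h3, h4, hev.1]; ring
      · have h1 := hasDerivAt_evalAt (hq x hx) (hr x hx) (aknsK n).2
        have h2 : HasDerivAt (fun y => evalAt (aknsK n).2 q r y)
            (-((b (n + 1 + 1) x + 2 * r x * a (n + 1) x) / 2)) x := by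
          refine ((hb x hx (n + 1)).div_const 2).neg.congr_of_eventuallyEq ?_
          filter_upwards [hnhds] with y hy using (ih n (by omega) hy).2.1
        have h3 := h1.unique h2
        have h4 := (ih n (by omega) hx).2.2
        rw [aknsK_snd_succ]
        simp only [evalAt, map_sub, map_mul, map_ofNat] at h3 h4 hev ⊢
        rw [h3, h4, hev.2]; ring
      -- The recursion for the integral terms and the normalization `hsq` are the same quadratic
      -- identity, up to the factors ±½.
      · have h1 : evalAt (aknsW (n + 1)) q r x = ∑ i ∈ Finset.range (n + 1),
            (evalAt (aknsW i) q r x * evalAt (aknsW (n - i)) q r x -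
              evalAt (aknsK i).1 q r x * evalAt (aknsK (n - i)).2 q r x) := by
          rw [aknsW_succ]; simp [evalAt]
        have h2 : ∀ i ∈ Finset.range (n + 1),
            (evalAt (aknsW i) q r x * evalAt (aknsW (n - i)) q r x -
              evalAt (aknsK i).1 q r x * evalAt (aknsK (n - i)).2 q r x) =
            (1 / 4) * (a (i + 1) x * a (n - i + 1) x + c (i + 1) x * b (n - i + 1) x) := by
          intro i hi
          have hi' : i < n + 1 := by simpa using hi
          obtain ⟨e1, -, e2⟩ := ih i hi' hx
          obtain ⟨-, e3, e4⟩ := ih (n - i) (by omega) hx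
          rw [e1, e2, e3, e4]; ring
        rw [h1, Finset.sum_congr rfl h2, ← Finset.mul_sum]
        linear_combination (1 / 4) * hsq x hx n

end Evaluation

/-! ### Linear relations between Krylov vectors -/

section Relation

open PowerSeries

/-- The Pauli matrix `σ₃`. -/
def pauli : Matrix (Fin 2) (Fin 2) ℂ := !![1, 0; 0, -1]

theorem pauli_mul_self : pauli * pauli = 1 := by
  simp [pauli, Matrix.one_fin_two]

theorem mul_pauli_apply_zero (B : Matrix (Fin 2) (Fin 2) ℂ) (i : Fin 2) :
    (B * pauli) i 0 = B i 0 := by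
  simp [pauli, Matrix.mul_apply, Fin.sum_univ_two]

theorem mul_pauli_apply_one (B : Matrix (Fin 2) (Fin 2) ℂ) (i : Fin 2) :
    (B * pauli) i 1 = -B i 1 := by
  simp [pauli, Matrix.mul_apply, Fin.sum_univ_two]

variable {N : ℕ}

/-- The value on `(φ, ψ)` of the `i`-th row of the Laurent polynomial matrix
`Y(A⁻¹) diag(A^{m+2}, A^{m+1})`. -/
noncomputable def relation (A : Matrix (Fin N) (Fin N) ℂ) (m : ℕ) (φ ψ : Fin N → ℂ) (i : Fin 2) :
    (Matrix (Fin 2) (Fin 2) ℂ)⟦X⟧ →ₗ[ℂ] (Fin N → ℂ) where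
  toFun Y := ∑ k ∈ Finset.range (m + 3), (coeff k Y i 0) • (A ^ (m + 2 - k) *ᵥ φ) +
    ∑ k ∈ Finset.range (m + 2), (coeff k Y i 1) • (A ^ (m + 1 - k) *ᵥ ψ)
  map_add' Y Z := by
    simp only [map_add, Matrix.add_apply, add_smul, Finset.sum_add_distrib]
    abel
  map_smul' c Y := by
    simp only [coeff_smul, Matrix.smul_apply, smul_eq_mul, mul_smul, ← Finset.smul_sum,
      ← smul_add, RingHom.id_apply]

theorem relation_apply (A : Matrix (Fin N) (Fin N) ℂ) (m : ℕ) (φ ψ : Fin N → ℂ) (i : Fin 2)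
    (Y : (Matrix (Fin 2) (Fin 2) ℂ)⟦X⟧) :
    relation A m φ ψ i Y =
      ∑ k ∈ Finset.range (m + 3), (coeff k Y i 0) • (A ^ (m + 2 - k) *ᵥ φ) +
        ∑ k ∈ Finset.range (m + 2), (coeff k Y i 1) • (A ^ (m + 1 - k) *ᵥ ψ) := rfl

/-- `Y(λ⁻¹) diag(λ^{m+2}, λ^{m+1})` is polynomial in `λ`. -/
def Admissible (m : ℕ) (Y : (Matrix (Fin 2) (Fin 2) ℂ)⟦X⟧) : Prop :=
  ∀ i, (∀ k, m + 2 < k → coeff k Y i 0 = 0) ∧ (∀ k, m + 1 < k → coeff k Y i 1 = 0)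

variable {A : Matrix (Fin N) (Fin N) ℂ} {m : ℕ} {φ ψ : Fin N → ℂ}

theorem relation_C_mul (B : Matrix (Fin 2) (Fin 2) ℂ) (Y : (Matrix (Fin 2) (Fin 2) ℂ)⟦X⟧)
    (i : Fin 2) :
    relation A m φ ψ i (C B * Y) = ∑ j, B i j • relation A m φ ψ j Y := by
  simp only [relation_apply, coeff_C_mul, Matrix.mul_apply, Fin.sum_univ_two, add_smul, mul_smul,
    Finset.sum_add_distrib, ← Finset.smul_sum, smul_add]

/-- Multiplication by λ acts as A. The vanishing constant term keeps λY a power series;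
admissibility kills the coefficient that would leave the range of summation. -/
theorem relation_shift {Y Z : (Matrix (Fin 2) (Fin 2) ℂ)⟦X⟧} (hY : Admissible m Y)
    (h0 : coeff 0 Y = 0) (hZ : ∀ k, coeff k Z = coeff (k + 1) Y) (i : Fin 2) :
    relation A m φ ψ i Z = A *ᵥ relation A m φ ψ i Y := by
  simp only [relation_apply, hZ, Matrix.mulVec_add, Matrix.mulVec_sum, Matrix.mulVec_smul,
    Matrix.mulVec_mulVec]
  congr 1
  · rw [Finset.sum_range_succ, (hY i).1 (m + 2 + 1) (by omega), Finset.sum_range_succ' _ (m + 2),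
      h0, Matrix.zero_apply, zero_smul, zero_smul]
    congr 1
    refine Finset.sum_congr rfl fun k hk => ?_
    have := Finset.mem_range.mp hk
    rw [← pow_succ', show m + 2 - (k + 1) + 1 = m + 2 - k by omega]
  · rw [Finset.sum_range_succ, (hY i).2 (m + 1 + 1) (by omega), Finset.sum_range_succ' _ (m + 1),
      h0, Matrix.zero_apply, zero_smul, zero_smul]
    congr 1
    refine Finset.sum_congr rfl fun k hk => ?_
    have := Finset.mem_range.mp hk
    rw [← pow_succ', show m + 1 - (k + 1) + 1 = m + 1 - k by omega]

theorem Admissible.C_mul (B : Matrix (Fin 2) (Fin 2) ℂ) {Y : (Matrix (Fin 2) (Fin 2) ℂ)⟦X⟧}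
    (hY : Admissible m Y) : Admissible m (C B * Y) := by
  intro i
  refine ⟨fun k hk => ?_, fun k hk => ?_⟩
  · simp [coeff_C_mul, Matrix.mul_apply, (hY _).1 k hk]
  · simp [coeff_C_mul, Matrix.mul_apply, (hY _).2 k hk]

theorem Admissible.mul_C_pauli {Y : (Matrix (Fin 2) (Fin 2) ℂ)⟦X⟧}
    (hY : Admissible m Y) : Admissible m (Y * C pauli) := by
  intro i
  refine ⟨fun k hk => ?_, fun k hk => ?_⟩
  · rw [coeff_mul_C, mul_pauli_apply_zero, (hY i).1 k hk]
  · rw [coeff_mul_C, mul_pauli_apply_one, (hY i).2 k hk, neg_zero]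

theorem Admissible.sub {Y Z : (Matrix (Fin 2) (Fin 2) ℂ)⟦X⟧}
    (hY : Admissible m Y) (hZ : Admissible m Z) : Admissible m (Y - Z) := by
  intro i
  refine ⟨fun k hk => ?_, fun k hk => ?_⟩
  · rw [map_sub, Matrix.sub_apply, (hY i).1 k hk, (hZ i).1 k hk, sub_zero]
  · rw [map_sub, Matrix.sub_apply, (hY i).2 k hk, (hZ i).2 k hk, sub_zero]

theorem Admissible.smul (c : ℂ) {Y : (Matrix (Fin 2) (Fin 2) ℂ)⟦X⟧}
    (hY : Admissible m Y) : Admissible m (c • Y) := by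
  intro i
  refine ⟨fun k hk => ?_, fun k hk => ?_⟩
  · rw [coeff_smul, Matrix.smul_apply, (hY i).1 k hk, smul_zero]
  · rw [coeff_smul, Matrix.smul_apply, (hY i).2 k hk, smul_zero]

/-- One has λⁿRW = λⁿWσ₃, and the discarded part of λⁿR is a polynomial in λ with matrix
coefficients. Multiplied by W it contributes only images of the relations of W, which vanish. -/
theorem relation_tail {W : (Matrix (Fin 2) (Fin 2) ℂ)⟦X⟧} (hW : Admissible m W)
    (h1 : constantCoeff W = 1) (hrel : ∀ i, relation A m φ ψ i W = 0) (n : ℕ) :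
    Admissible m (tail n (dress W pauli) * W) ∧
      ∀ i, relation A m φ ψ i (tail n (dress W pauli) * W) =
        A ^ n *ᵥ relation A m φ ψ i (W * C pauli) := by
  induction n with
  | zero =>
    rw [tail_zero_dress_mul h1]
    refine ⟨hW.mul_C_pauli.sub (hW.C_mul _), fun i => ?_⟩
    rw [map_sub, relation_C_mul]
    simp [hrel]
  | succ n ih =>
    let B := coeff (n + 1) (dress W pauli)
    let Z : (Matrix (Fin 2) (Fin 2) ℂ)⟦X⟧ :=
      PowerSeries.mk fun k => coeff (k + 1) (tail n (dress W pauli) * W)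
    have hZ : ∀ k, coeff k Z = coeff (k + 1) (tail n (dress W pauli) * W) := by simp [Z]
    have e : tail (n + 1) (dress W pauli) * W = Z - C B * W := by
      ext k : 1
      rw [coeff_tail_mul_succ, map_sub, hZ, coeff_C_mul]
    have hZa : Admissible m Z := fun i =>
      ⟨fun k hk => by rw [hZ, (ih.1 i).1 (k + 1) (by omega)],
        fun k hk => by rw [hZ, (ih.1 i).2 (k + 1) (by omega)]⟩
    rw [e]
    refine ⟨hZa.sub (hW.C_mul _), fun i => ?_⟩
    rw [map_sub, relation_C_mul, relation_shift ih.1 _ hZ, ih.2]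
    · simp [hrel, pow_succ']
    · rw [coeff_zero_eq_constantCoeff_apply, map_mul, constantCoeff_tail, zero_mul]

section

open scoped Matrix.Norms.Operator

theorem HasCoeffDerivAt.apply {W : ℂ → (Matrix (Fin 2) (Fin 2) ℂ)⟦X⟧}
    {W' : (Matrix (Fin 2) (Fin 2) ℂ)⟦X⟧} {s : ℂ} (h : HasCoeffDerivAt W W' s) (k : ℕ)
    (i j : Fin 2) : HasDerivAt (fun s => coeff k (W s) i j) (coeff k W' i j) s :=
  hasDerivAt_pi.mp (hasDerivAt_pi.mp (h k) i) j

/-- Sato's equation `W' = -½ (λⁿ W σ₃ W⁻¹)₋ W` for the dressing series of two vectors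
that evolve by `φ' = ½ Aⁿ φ` and `ψ' = -½ Aⁿ ψ`. -/
theorem sato_equation {n : ℕ} {φ ψ : ℂ → Fin N → ℂ} {s : ℂ}
    (hφ : HasDerivAt φ ((1 / 2 : ℂ) • (A ^ n *ᵥ φ s)) s)
    (hψ : HasDerivAt ψ (-((1 / 2 : ℂ) • (A ^ n *ᵥ ψ s))) s)
    {W : ℂ → (Matrix (Fin 2) (Fin 2) ℂ)⟦X⟧} {W' : (Matrix (Fin 2) (Fin 2) ℂ)⟦X⟧}
    (hW' : HasCoeffDerivAt W W' s) (h1 : ∀ s, constantCoeff (W s) = 1)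
    (hadm : ∀ s, Admissible m (W s))
    (hrel : ∀ᶠ s in nhds s, ∀ i, relation A m (φ s) (ψ s) i (W s) = 0)
    (hnd : ∀ Y, Admissible m Y → coeff 0 Y = 0 → (∀ i, relation A m (φ s) (ψ s) i Y = 0) →
      Y = 0) :
    W' = -((1 / 2 : ℂ) • (tail n (dress (W s) pauli) * W s)) := by
  have hadm' : Admissible m W' := fun i => by
    refine ⟨fun k hk => ?_, fun k hk => ?_⟩
    · refine (hW'.apply k i 0).unique ?_
      simpa only [(hadm _ i).1 k hk] using hasDerivAt_const s (0 : ℂ)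
    · refine (hW'.apply k i 1).unique ?_
      simpa only [(hadm _ i).2 k hk] using hasDerivAt_const s (0 : ℂ)
  have h0' : coeff 0 W' = 0 := by
    refine (hW' 0).unique ?_
    simpa only [coeff_zero_eq_constantCoeff, h1] using
      hasDerivAt_const s (1 : Matrix (Fin 2) (Fin 2) ℂ)
  have hpow : ∀ (B : Matrix (Fin N) (Fin N) ℂ) (u : ℂ → Fin N → ℂ) (u' : Fin N → ℂ),
      HasDerivAt u u' s → HasDerivAt (fun s => B *ᵥ u s) (B *ᵥ u') s := by
    intro B u u' hu
    exact (LinearMap.toContinuousLinearMap (Matrix.mulVecLin B)).hasFDerivAt.comp_hasDerivAt s hu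
  -- The derivative of the vanishing relation. The opposite signs in the evolutions of φ and ψ are
  -- recorded by the factor σ₃ on the right of W.
  have hder : ∀ i, relation A m (φ s) (ψ s) i W' +
      (1 / 2 : ℂ) • (A ^ n *ᵥ relation A m (φ s) (ψ s) i (W s * C pauli)) = 0 := by
    intro i
    have hd : HasDerivAt (fun s => relation A m (φ s) (ψ s) i (W s)) 0 s := by
      refine (hasDerivAt_const s (0 : Fin N → ℂ)).congr_of_eventuallyEq ?_
      filter_upwards [hrel] with s hs using hs i
    refine HasDerivAt.unique ?_ hd
    simp only [relation_apply]
    refine ((HasDerivAt.fun_sum fun k _ => (hW'.apply k i 0).fun_smul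
      (hpow (A ^ (m + 2 - k)) φ _ hφ)).fun_add (HasDerivAt.fun_sum fun k _ =>
        (hW'.apply k i 1).fun_smul (hpow (A ^ (m + 1 - k)) ψ _ hψ))).congr_deriv ?_
    simp only [coeff_mul_C, mul_pauli_apply_zero, mul_pauli_apply_one, Finset.sum_add_distrib,
      Matrix.mulVec_add, Matrix.mulVec_sum, Matrix.mulVec_smul, Matrix.mulVec_neg,
      Matrix.mulVec_mulVec, smul_add, Finset.smul_sum, neg_smul, smul_neg,
      ← pow_add, add_comm n, Finset.sum_neg_distrib, smul_comm (1 / 2 : ℂ)]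
    abel
  obtain ⟨ht, ht'⟩ := relation_tail (A := A) (hadm s) (h1 s) hrel.self_of_nhds n
  rw [← sub_eq_zero]
  -- The difference of the two sides is admissible, has no constant term and satisfies all
  -- relations, so nondegeneracy makes it zero.
  refine hnd _ ?_ ?_ fun i => ?_
  · rw [← neg_smul]
    exact hadm'.sub (ht.smul _)
  · rw [map_sub, map_neg, coeff_smul, h0', coeff_zero_eq_constantCoeff_apply, map_mul,
      constantCoeff_tail]
    simp
  · rw [sub_neg_eq_add, map_add, map_smul, ht', hder]

end

end Relation

/-! ### The dressing series of two Krylov sequences -/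

section Krylov

open PowerSeries

variable {m : ℕ} {A : Matrix (Fin (2 * m + 3)) (Fin (2 * m + 3)) ℂ} {φ ψ : Fin (2 * m + 3) → ℂ}

/-- The matrix with the columns `(A/2)ʲ φ`, `j < a`, followed by the `(-A/2)ʲ ψ`. -/
noncomputable def krylov {N : ℕ} (a : ℕ) (A : Matrix (Fin N) (Fin N) ℂ) (φ ψ : Fin N → ℂ) :
    Matrix (Fin N) (Fin N) ℂ :=
  Matrix.of fun i j => if (j : ℕ) < a then (((1 / 2 : ℂ) ^ (j : ℕ)) • (A ^ (j : ℕ) *ᵥ φ)) i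
    else (((-1 / 2 : ℂ) ^ ((j : ℕ) - a)) • (A ^ ((j : ℕ) - a) *ᵥ ψ)) i

theorem krylov_mulVec (A : Matrix (Fin (2 * m + 3)) (Fin (2 * m + 3)) ℂ)
    (φ ψ : Fin (2 * m + 3) → ℂ) (c : ℕ → ℂ) :
    krylov (m + 2) A φ ψ *ᵥ (fun j => c j) =
      ∑ j ∈ Finset.range (m + 2), (c j * (1 / 2) ^ j) • (A ^ j *ᵥ φ) +
        ∑ j ∈ Finset.range (m + 1), (c (m + 2 + j) * (-1 / 2) ^ j) • (A ^ j *ᵥ ψ) := by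
  ext i
  let g : ℕ → ℂ := fun j => (if j < m + 2 then (((1 / 2 : ℂ) ^ j) • (A ^ j *ᵥ φ)) i
    else (((-1 / 2 : ℂ) ^ (j - (m + 2))) • (A ^ (j - (m + 2)) *ᵥ ψ)) i) * c j
  have h1 : (krylov (m + 2) A φ ψ *ᵥ (fun j => c j)) i = ∑ j : Fin (2 * m + 3), g j := rfl
  have h2 : ∑ j ∈ Finset.range (2 * m + 3), g j =
      ∑ j ∈ Finset.range (m + 2), g j + ∑ j ∈ Finset.range (m + 1), g (m + 2 + j) := by
    rw [← Finset.sum_range_add]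
    congr 2
    ring
  rw [h1, Fin.sum_univ_eq_sum_range g, h2, Pi.add_apply, Finset.sum_apply, Finset.sum_apply]
  congr 1
  · refine Finset.sum_congr rfl fun j hj => ?_
    simp only [g, if_pos (Finset.mem_range.mp hj), Pi.smul_apply, smul_eq_mul]
    ring
  · refine Finset.sum_congr rfl fun j hj => ?_
    simp only [g, if_neg (show ¬ m + 2 + j < m + 2 by omega), Pi.smul_apply, smul_eq_mul,
      Nat.add_sub_cancel_left]
    ring

/-- The coordinates, with respect to the columns of `krylov (m + 2) A φ ψ`, of the terms of
positive degree in the `i`-th relation of the series `Y`. -/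
noncomputable def krylovCoord (m : ℕ) (Y : (Matrix (Fin 2) (Fin 2) ℂ)⟦X⟧) (i : Fin 2) (j : ℕ) :
    ℂ :=
  if j < m + 2 then 2 ^ j * coeff (m + 2 - j) Y i 0
    else (-2) ^ (j - (m + 2)) * coeff (2 * m + 3 - j) Y i 1

/-- Only the constant coefficient of Y involves vectors outside the Krylov columns. The factors 2ʲ
and (-2)ʲ in `krylovCoord` undo the scaling of the columns. -/
theorem relation_eq_krylov_mulVec (A : Matrix (Fin (2 * m + 3)) (Fin (2 * m + 3)) ℂ)
    (φ ψ : Fin (2 * m + 3) → ℂ) (i : Fin 2) (Y : (Matrix (Fin 2) (Fin 2) ℂ)⟦X⟧) :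
    relation A m φ ψ i Y = krylov (m + 2) A φ ψ *ᵥ (fun j => krylovCoord m Y i j) +
      (coeff 0 Y i 0 • (A ^ (m + 2) *ᵥ φ) + coeff 0 Y i 1 • (A ^ (m + 1) *ᵥ ψ)) := by
  have h1 : ∑ k ∈ Finset.range (m + 3), (coeff k Y i 0) • (A ^ (m + 2 - k) *ᵥ φ) =
      ∑ j ∈ Finset.range (m + 3), (coeff (m + 2 - j) Y i 0) • (A ^ j *ᵥ φ) := by
    rw [← Finset.sum_flip]
    refine Finset.sum_congr rfl fun k hk => ?_
    rw [Nat.sub_sub_self (Nat.lt_succ_iff.mp (Finset.mem_range.mp hk))]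
  have h2 : ∑ k ∈ Finset.range (m + 2), (coeff k Y i 1) • (A ^ (m + 1 - k) *ᵥ ψ) =
      ∑ j ∈ Finset.range (m + 2), (coeff (m + 1 - j) Y i 1) • (A ^ j *ᵥ ψ) := by
    rw [← Finset.sum_flip]
    refine Finset.sum_congr rfl fun k hk => ?_
    rw [Nat.sub_sub_self (Nat.lt_succ_iff.mp (Finset.mem_range.mp hk))]
  rw [relation_apply, h1, h2, krylov_mulVec, Finset.sum_range_succ _ (m + 2),
    Finset.sum_range_succ (fun j => coeff (m + 1 - j) Y i 1 • (A ^ j *ᵥ ψ)) (m + 1),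
    Nat.sub_self, Nat.sub_self, add_add_add_comm]
  congr 2
  · refine Finset.sum_congr rfl fun j hj => ?_
    rw [krylovCoord, if_pos (Finset.mem_range.mp hj), mul_right_comm, ← mul_pow]
    norm_num
  · refine Finset.sum_congr rfl fun j hj => ?_
    rw [krylovCoord, if_neg (show ¬ m + 2 + j < m + 2 by omega), mul_right_comm,
      Nat.add_sub_cancel_left, ← mul_pow, show 2 * m + 3 - (m + 2 + j) = m + 1 - j by omega]
    norm_num

/-- Without constant term, a row of Y has (m + 2) + (m + 1) = 2m + 3 free coefficients, one for each
Krylov column. -/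
theorem eq_zero_of_relation_eq_zero (hdet : (krylov (m + 2) A φ ψ).det ≠ 0)
    {Y : (Matrix (Fin 2) (Fin 2) ℂ)⟦X⟧} (hY : Admissible m Y) (h0 : coeff 0 Y = 0)
    (hrel : ∀ i, relation A m φ ψ i Y = 0) : Y = 0 := by
  have hc : ∀ i, ∀ j < 2 * m + 3, krylovCoord m Y i j = 0 := by
    intro i j hj
    have h := hrel i
    rw [relation_eq_krylov_mulVec, h0, Matrix.zero_apply, Matrix.zero_apply, zero_smul, zero_smul,
      add_zero, add_zero] at h
    exact congrFun (Matrix.eq_zero_of_mulVec_eq_zero hdet h) ⟨j, hj⟩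
  ext k i j
  rw [map_zero, Matrix.zero_apply]
  rcases Nat.eq_zero_or_pos k with rfl | hk
  · rw [h0, Matrix.zero_apply]
  fin_cases j
  · by_cases hk' : m + 2 < k
    · exact (hY i).1 k hk'
    · have h := hc i (m + 2 - k) (by omega)
      rw [krylovCoord, if_pos (by omega), Nat.sub_sub_self (by omega)] at h
      simpa using h
  · by_cases hk' : m + 1 < k
    · exact (hY i).2 k hk'
    · have h := hc i (2 * m + 3 - k) (by omega)
      rw [krylovCoord, if_neg (by omega), Nat.sub_sub_self (by omega)] at h
      simpa using h

/-- The coordinates of `-A^{m+2} φ` and `-A^{m+1} ψ` with respect to the columns of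
`krylov (m + 2) A φ ψ`. -/
noncomputable def leadingCoord (A : Matrix (Fin (2 * m + 3)) (Fin (2 * m + 3)) ℂ)
    (φ ψ : Fin (2 * m + 3) → ℂ) (i : Fin 2) : Fin (2 * m + 3) → ℂ :=
  -((krylov (m + 2) A φ ψ)⁻¹ *ᵥ
    (if i = 0 then A ^ (m + 2) *ᵥ φ else A ^ (m + 1) *ᵥ ψ))

/-- The dressing series: its rows are the reversed coefficients of the linear relations that express
`A^{m+2} φ` and `A^{m+1} ψ` in the columns of `krylov (m + 2) A φ ψ`. -/
noncomputable def dressing (A : Matrix (Fin (2 * m + 3)) (Fin (2 * m + 3)) ℂ)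
    (φ ψ : Fin (2 * m + 3) → ℂ) : (Matrix (Fin 2) (Fin 2) ℂ)⟦X⟧ :=
  PowerSeries.mk fun k => if k = 0 then 1 else
    Matrix.of fun i j => if j = 0
      then (if k ≤ m + 2 then
        (1 / 2) ^ (m + 2 - k) * leadingCoord A φ ψ i (Fin.ofNat _ (m + 2 - k)) else 0)
      else (if k ≤ m + 1 then
        (-1 / 2) ^ (m + 1 - k) * leadingCoord A φ ψ i (Fin.ofNat _ (2 * m + 3 - k)) else 0)

theorem coeff_zero_dressing (A : Matrix (Fin (2 * m + 3)) (Fin (2 * m + 3)) ℂ)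
    (φ ψ : Fin (2 * m + 3) → ℂ) : coeff 0 (dressing A φ ψ) = 1 := by
  simp [dressing]

theorem constantCoeff_dressing (A : Matrix (Fin (2 * m + 3)) (Fin (2 * m + 3)) ℂ)
    (φ ψ : Fin (2 * m + 3) → ℂ) : constantCoeff (dressing A φ ψ) = 1 := by
  rw [← coeff_zero_eq_constantCoeff_apply, coeff_zero_dressing]

theorem admissible_dressing (A : Matrix (Fin (2 * m + 3)) (Fin (2 * m + 3)) ℂ)
    (φ ψ : Fin (2 * m + 3) → ℂ) : Admissible m (dressing A φ ψ) := by
  intro i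
  refine ⟨fun k hk => ?_, fun k hk => ?_⟩
  · simp [dressing, show k ≠ 0 by omega, show ¬ k ≤ m + 2 by omega]
  · simp [dressing, show k ≠ 0 by omega, show ¬ k ≤ m + 1 by omega]

/-- The weights in `dressing` and `krylovCoord` are inverse to each other, and the indices under
`Fin.ofNat` that occur here are below 2m + 3, so nothing is reduced. -/
theorem krylovCoord_dressing (i : Fin 2) (j : Fin (2 * m + 3)) :
    krylovCoord m (dressing A φ ψ) i j = leadingCoord A φ ψ i j := by
  have hj := j.isLt
  by_cases h : (j : ℕ) < m + 2
  · rw [krylovCoord, if_pos h, dressing, coeff_mk, if_neg (by omega), Matrix.of_apply, if_pos rfl,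
      if_pos (by omega), Nat.sub_sub_self (by omega), ← mul_assoc, ← mul_pow, Fin.ofNat_eq_cast,
      Fin.cast_val_eq_self]
    norm_num
  · rw [krylovCoord, if_neg h, dressing, coeff_mk, if_neg (by omega), Matrix.of_apply,
      if_neg (by decide), if_pos (by omega), Nat.sub_sub_self (by omega),
      show m + 1 - (2 * m + 3 - j) = (j : ℕ) - (m + 2) by omega, ← mul_assoc, ← mul_pow,
      Fin.ofNat_eq_cast, Fin.cast_val_eq_self]
    norm_num

theorem krylov_mulVec_leadingCoord (hdet : (krylov (m + 2) A φ ψ).det ≠ 0) (i : Fin 2) :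
    krylov (m + 2) A φ ψ *ᵥ leadingCoord A φ ψ i =
      -(if i = 0 then A ^ (m + 2) *ᵥ φ else A ^ (m + 1) *ᵥ ψ) := by
  rw [leadingCoord, Matrix.mulVec_neg, Matrix.mulVec_mulVec,
    Matrix.mul_nonsing_inv _ (isUnit_iff_ne_zero.mpr hdet), Matrix.one_mulVec]

theorem relation_dressing (hdet : (krylov (m + 2) A φ ψ).det ≠ 0) (i : Fin 2) :
    relation A m φ ψ i (dressing A φ ψ) = 0 := by
  rw [relation_eq_krylov_mulVec, coeff_zero_dressing]
  simp only [krylovCoord_dressing]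
  rw [krylov_mulVec_leadingCoord hdet]
  obtain rfl | rfl : i = 0 ∨ i = 1 := by omega
  · simp
  · simp

theorem leadingCoord_apply (hdet : (krylov (m + 2) A φ ψ).det ≠ 0) (i : Fin 2)
    (j : Fin (2 * m + 3)) :
    leadingCoord A φ ψ i j = -(((krylov (m + 2) A φ ψ).updateCol j
      (if i = 0 then A ^ (m + 2) *ᵥ φ else A ^ (m + 1) *ᵥ ψ)).det /
        (krylov (m + 2) A φ ψ).det) := by
  rw [← Matrix.cramer_apply, ← neg_eq_iff_eq_neg.mpr (krylov_mulVec_leadingCoord hdet i), map_neg, Matrix.cramer_eq_adjugate_mulVec, Matrix.mulVec_mulVec, Matrix.adjugate_mul,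
    Matrix.smul_mulVec, Matrix.one_mulVec]
  simp only [Pi.neg_apply, Pi.smul_apply, smul_eq_mul]
  field_simp

section

open scoped Matrix.Norms.Operator

theorem differentiableAt_leadingCoord {φ ψ : ℂ → Fin (2 * m + 3) → ℂ} {s : ℂ}
    (hφ : DifferentiableAt ℂ φ s) (hψ : DifferentiableAt ℂ ψ s)
    (hdet : (krylov (m + 2) A (φ s) (ψ s)).det ≠ 0) (i : Fin 2) (j : Fin (2 * m + 3)) :
    DifferentiableAt ℂ (fun s => leadingCoord A (φ s) (ψ s) i j) s := by
  have hmul : ∀ (B : Matrix (Fin (2 * m + 3)) (Fin (2 * m + 3)) ℂ)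
      (u : ℂ → Fin (2 * m + 3) → ℂ), DifferentiableAt ℂ u s → ∀ l,
        DifferentiableAt ℂ (fun s => (B *ᵥ u s) l) s := by
    intro B u hu l
    simp only [Matrix.mulVec, dotProduct]
    exact DifferentiableAt.fun_sum fun x _ => (differentiableAt_pi.mp hu x).const_mul _
  have hF : DifferentiableAt ℂ (fun s => krylov (m + 2) A (φ s) (ψ s)) s := by
    refine differentiableAt_pi.mpr fun k => differentiableAt_pi.mpr fun l => ?_
    simp only [krylov, Matrix.of_apply, Pi.smul_apply, smul_eq_mul]
    split_ifs
    · exact (hmul _ φ hφ k).const_mul _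
    · exact (hmul _ ψ hψ k).const_mul _
  have hinv : DifferentiableAt ℂ (fun s => (krylov (m + 2) A (φ s) (ψ s))⁻¹) s := by
    simp only [Matrix.nonsing_inv_eq_ringInverse]
    exact (differentiableAt_inverse
      ((Matrix.isUnit_iff_isUnit_det _).mpr (isUnit_iff_ne_zero.mpr hdet))).comp s hF
  simp only [leadingCoord, Pi.neg_apply, Matrix.mulVec, dotProduct]
  refine (DifferentiableAt.fun_sum fun x _ => ?_).fun_neg
  refine (differentiableAt_pi.mp (differentiableAt_pi.mp hinv j) x).fun_mul ?_
  by_cases hi : i = 0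
  · simpa only [hi, if_true] using hmul _ φ hφ x
  · simpa only [hi, if_false] using hmul _ ψ hψ x

/-- The coefficients are differentiable because they come from the inverse Krylov matrix; uniqueness
of the relations then identifies the derivative. -/
theorem hasCoeffDerivAt_dressing {n : ℕ} {φ ψ : ℂ → Fin (2 * m + 3) → ℂ} {s : ℂ}
    (hφ : HasDerivAt φ ((1 / 2 : ℂ) • (A ^ n *ᵥ φ s)) s)
    (hψ : HasDerivAt ψ (-((1 / 2 : ℂ) • (A ^ n *ᵥ ψ s))) s)
    (hdet : ∀ᶠ s in nhds s, (krylov (m + 2) A (φ s) (ψ s)).det ≠ 0) :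
    HasCoeffDerivAt (fun s => dressing A (φ s) (ψ s))
      (-((1 / 2 : ℂ) • (tail n (dress (dressing A (φ s) (ψ s)) pauli) *
        dressing A (φ s) (ψ s)))) s := by
  let W' : (Matrix (Fin 2) (Fin 2) ℂ)⟦X⟧ :=
    PowerSeries.mk fun k => deriv (fun s => coeff k (dressing A (φ s) (ψ s))) s
  have hd := differentiableAt_leadingCoord (A := A) hφ.differentiableAt hψ.differentiableAt
    hdet.self_of_nhds
  have hW' : HasCoeffDerivAt (fun s => dressing A (φ s) (ψ s)) W' s := by
    intro k
    rw [coeff_mk]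
    refine DifferentiableAt.hasDerivAt ?_
    simp only [dressing, coeff_mk]
    by_cases hk : k = 0
    · simp [hk]
    · simp only [hk, if_false]
      refine differentiableAt_pi.mpr fun i => differentiableAt_pi.mpr fun j => ?_
      simp only [Matrix.of_apply]
      split_ifs
      · exact (hd _ _).const_mul _
      · exact differentiableAt_const _
      · exact (hd _ _).const_mul _
      · exact differentiableAt_const _
  have h := sato_equation hφ hψ hW' (fun s => constantCoeff_dressing A (φ s) (ψ s))
    (fun s => admissible_dressing A (φ s) (ψ s))
    (hdet.mono fun s hs i => relation_dressing hs i)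
    (fun Y hY h0 hrel => eq_zero_of_relation_eq_zero hdet.self_of_nhds hY h0 hrel)
  rwa [h] at hW'

end

end Krylov

/-! ### Double Wronskians of the flows -/

section Determinants

variable {N : ℕ}

/-- Adjacent Krylov matrices differ in one column, up to the cycle that moves column a to the end.
This links Cramer's determinants to double Wronskians. -/
theorem krylov_succ_submatrix (a : Fin (N + 1)) (A : Matrix (Fin (N + 1)) (Fin (N + 1)) ℂ)
    (φ ψ : Fin (N + 1) → ℂ) :
    (krylov (a + 1) A φ ψ).submatrix id (Fin.cycleIcc a (Fin.last N)) =
      (krylov a A φ ψ).updateCol (Fin.last N) (((1 / 2 : ℂ) ^ (a : ℕ)) • (A ^ (a : ℕ) *ᵥ φ)) := by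
  ext i k
  rcases lt_or_ge k a with hk | hk
  · have hne : k ≠ Fin.last N := (lt_of_lt_of_le hk (Fin.le_last a)).ne
    simp [Fin.cycleIcc_of_lt hk, krylov, Matrix.updateCol_ne hne, hk, hk.le]
  · rcases eq_or_ne k (Fin.last N) with rfl | hne
    · simp [Fin.cycleIcc_of_last hk, krylov]
    · have hlt : k < Fin.last N := lt_of_le_of_ne (Fin.le_last k) hne
      have hv : ((k + 1 : Fin (N + 1)) : ℕ) = k + 1 := Fin.val_add_one_of_lt hlt
      have hk' : ¬ k + 1 ≤ a := fun h => by
        have h1 : ((k + 1 : Fin (N + 1)) : ℕ) ≤ a := h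
        have h2 : (a : ℕ) ≤ k := hk
        omega
      simp [Fin.cycleIcc_of_ge_of_lt hk hlt, krylov, Matrix.updateCol_ne hne, hv, hk', not_lt.mpr hk]

theorem krylov_eq_updateCol_submatrix (a : Fin (N + 1))
    (A : Matrix (Fin (N + 1)) (Fin (N + 1)) ℂ) (φ ψ : Fin (N + 1) → ℂ) :
    krylov a A φ ψ = ((krylov (a + 1) A φ ψ).updateCol a
      (((-1 / 2 : ℂ) ^ (N - a : ℕ)) • (A ^ (N - a : ℕ) *ᵥ ψ))).submatrix id
        (Fin.cycleIcc a (Fin.last N)) := by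
  ext i k
  rcases lt_or_ge k a with hk | hk
  · simp [Fin.cycleIcc_of_lt hk, krylov, Matrix.updateCol_ne hk.ne, hk, hk.le]
  · rcases eq_or_ne k (Fin.last N) with rfl | hne
    · simp [Fin.cycleIcc_of_last hk, krylov, not_lt.mpr hk]
    · have hlt : k < Fin.last N := lt_of_le_of_ne (Fin.le_last k) hne
      have hv : ((k + 1 : Fin (N + 1)) : ℕ) = k + 1 := Fin.val_add_one_of_lt hlt
      have hk' : ¬ k + 1 ≤ a := fun h => by
        have h1 : ((k + 1 : Fin (N + 1)) : ℕ) ≤ a := h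
        have h2 : (a : ℕ) ≤ k := hk
        omega
      have hka : k + 1 ≠ a := fun h => hk' h.le
      simp [Fin.cycleIcc_of_ge_of_lt hk hlt, krylov, Matrix.updateCol_ne hka, hv, hk', not_lt.mpr hk]

theorem det_krylov_succ (a : Fin (N + 1)) (A : Matrix (Fin (N + 1)) (Fin (N + 1)) ℂ)
    (φ ψ : Fin (N + 1) → ℂ) :
    (krylov (a + 1) A φ ψ).det = (-1) ^ (N - a : ℕ) * ((1 / 2) ^ (a : ℕ) *
      ((krylov a A φ ψ).updateCol (Fin.last N) (A ^ (a : ℕ) *ᵥ φ)).det) := by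
  rw [← Matrix.det_updateCol_smul, ← krylov_succ_submatrix, Matrix.det_permute',
    Fin.sign_cycleIcc_of_le (Fin.le_last a)]
  push_cast
  rw [← mul_assoc, ← mul_pow]
  norm_num

theorem det_krylov_eq (a : Fin (N + 1)) (A : Matrix (Fin (N + 1)) (Fin (N + 1)) ℂ)
    (φ ψ : Fin (N + 1) → ℂ) :
    (krylov a A φ ψ).det = (-1) ^ (N - a : ℕ) * ((-1 / 2) ^ (N - a : ℕ) *
      ((krylov (a + 1) A φ ψ).updateCol a (A ^ (N - a : ℕ) *ᵥ ψ)).det) := by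
  rw [← Matrix.det_updateCol_smul, krylov_eq_updateCol_submatrix, Matrix.det_permute',
    Fin.sign_cycleIcc_of_le (Fin.le_last a)]
  push_cast
  rfl

variable {m : ℕ}

theorem finRotate_pow_apply (k : ℕ) (j : Fin (N + 1)) :
    (((finRotate (N + 1)) ^ k) j : ℕ) = (j + k) % (N + 1) := by
  induction k with
  | zero => simp [Nat.mod_eq_of_lt j.isLt]
  | succ k ih =>
    rw [pow_succ', Equiv.Perm.mul_apply, finRotate_apply, Fin.val_add, ih, Fin.val_one']
    simp [add_assoc]

/-- T sends (A/2)ʲφ to (-A/2)ʲψ and conversely, so it turns the columns for m + 2 into a cyclic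
rotation of those for m + 1. -/
theorem det_krylov_of_intertwining {A T : Matrix (Fin (2 * m + 3)) (Fin (2 * m + 3)) ℂ}
    {φ ψ : Fin (2 * m + 3) → ℂ} (hAT : T * A = -A * T) (hφ : T *ᵥ φ = ψ) (hψ : T *ᵥ ψ = φ) :
    (krylov (m + 1) A φ ψ).det = T.det * (krylov (m + 2) A φ ψ).det := by
  have hpow : ∀ k : ℕ, T * A ^ k = (-1 : ℂ) ^ k • (A ^ k * T) := by
    intro k
    induction k with
    | zero => simp
    | succ k ih =>
      rw [pow_succ, ← mul_assoc, ih, smul_mul_assoc, mul_assoc, hAT, pow_succ, mul_assoc]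
      simp
  have hmul : ∀ (u : Fin (2 * m + 3) → ℂ) (c : ℂ) (k : ℕ),
      T *ᵥ (c ^ k • (A ^ k *ᵥ u)) = (-c) ^ k • (A ^ k *ᵥ (T *ᵥ u)) := by
    intro u c k
    rw [Matrix.mulVec_smul, Matrix.mulVec_mulVec, hpow, Matrix.smul_mulVec, Matrix.mulVec_mulVec,
      smul_smul, ← mul_pow]
    simp
  have h : T * krylov (m + 2) A φ ψ =
      (krylov (m + 1) A φ ψ).submatrix id ((finRotate (2 * m + 2 + 1)) ^ (m + 1)) := by
    ext i j
    have hj := j.isLt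
    have h1 : (T * krylov (m + 2) A φ ψ) i j =
        (T *ᵥ fun i => krylov (m + 2) A φ ψ i j) i := rfl
    rw [h1, Matrix.submatrix_apply, id]
    simp only [krylov, Matrix.of_apply]
    rw [finRotate_pow_apply]
    by_cases hlt : (j : ℕ) < m + 2
    · rw [Nat.mod_eq_of_lt (by omega), if_neg (by omega), Nat.add_sub_cancel]
      simp only [if_pos hlt]
      have h2 := congrFun (hmul φ (1 / 2) j) i
      rw [hφ] at h2
      rw [neg_div]
      exact h2
    · rw [show (j : ℕ) + (m + 1) = (j - (m + 2)) + (2 * m + 2 + 1) by omega, Nat.add_mod_right,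
        Nat.mod_eq_of_lt (by omega), if_pos (by omega)]
      simp only [if_neg hlt]
      have h2 := congrFun (hmul ψ (-1 / 2) (j - (m + 2))) i
      rw [hψ] at h2
      rw [show (1 / 2 : ℂ) = -(-1 / 2) by norm_num]
      exact h2
  -- A cycle of odd length 2m + 3 is even, so no sign appears.
  have hs : Equiv.Perm.sign ((finRotate (2 * m + 2 + 1)) ^ (m + 1)) = 1 := by
    rw [map_pow, sign_finRotate, Nat.add_sub_cancel, show 2 * m + 2 = 2 * (m + 1) by ring, pow_mul]
    simp
  rw [← Matrix.det_mul, h, Matrix.det_permute', hs]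
  simp

theorem coeff_one_dressing_zero_one {A : Matrix (Fin (2 * m + 3)) (Fin (2 * m + 3)) ℂ}
    {φ ψ : Fin (2 * m + 3) → ℂ} (hdet : (krylov (m + 2) A φ ψ).det ≠ 0) :
    PowerSeries.coeff 1 (dressing A φ ψ) 0 1 =
      -(4 * (krylov (m + 3) A φ ψ).det / (krylov (m + 2) A φ ψ).det) := by
  have h1 : PowerSeries.coeff 1 (dressing A φ ψ) 0 1 =
      (-1 / 2) ^ m * leadingCoord A φ ψ 0 (Fin.last (2 * m + 2)) := by
    have e : Fin.ofNat (2 * m + 3) (2 * m + 3 - 1) = Fin.last (2 * m + 2) := by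
      ext; simp
    rw [dressing, PowerSeries.coeff_mk, if_neg one_ne_zero, Matrix.of_apply, if_neg (by decide),
      if_pos (by omega), e, Nat.add_sub_cancel]
  have h2 := det_krylov_succ (N := 2 * m + 2) ⟨m + 2, by omega⟩ A φ ψ
  simp only [show 2 * m + 2 - (m + 2) = m by omega] at h2
  rw [h1, leadingCoord_apply hdet, if_pos rfl, h2]
  -- The 4 in r: a column scaled by 2⁻ᵐ is replaced by one scaled by 2^{-(m+2)}. The sign (-1)ᵐ is
  -- that of the column cycle.
  have h3 : (-1 / 2 : ℂ) ^ m = (-1) ^ m * (4 * (1 / 2) ^ (m + 2)) := by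
    rw [pow_add, neg_div, neg_pow]; ring
  rw [h3]; ring

theorem coeff_one_dressing_one_zero {A : Matrix (Fin (2 * m + 3)) (Fin (2 * m + 3)) ℂ}
    {φ ψ : Fin (2 * m + 3) → ℂ} (hdet : (krylov (m + 2) A φ ψ).det ≠ 0) :
    PowerSeries.coeff 1 (dressing A φ ψ) 1 0 =
      -((krylov (m + 1) A φ ψ).det / (krylov (m + 2) A φ ψ).det) := by
  have h1 : PowerSeries.coeff 1 (dressing A φ ψ) 1 0 =
      (1 / 2) ^ (m + 1) * leadingCoord A φ ψ 1 ⟨m + 1, by omega⟩ := by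
    have e : Fin.ofNat (2 * m + 3) (m + 2 - 1) = ⟨m + 1, by omega⟩ :=
      Fin.ext (Nat.mod_eq_of_lt (by omega))
    rw [dressing, PowerSeries.coeff_mk, if_neg one_ne_zero, Matrix.of_apply, if_pos rfl,
      if_pos (by omega), e]
    rfl
  have h2 := det_krylov_eq (N := 2 * m + 2) ⟨m + 1, by omega⟩ A φ ψ
  simp only [show 2 * m + 2 - (m + 1) = m + 1 by omega] at h2
  rw [h1, leadingCoord_apply hdet, if_neg (by decide), h2]
  have h3 : (1 / 2 : ℂ) ^ (m + 1) = (-1) ^ (m + 1) * (-1 / 2) ^ (m + 1) := by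
    rw [← mul_pow]; norm_num
  rw [h3]; ring

end Determinants

/-! ### Evolution of φ and ψ in the times -/

section Flow

variable {N : ℕ} {A : Matrix (Fin N) (Fin N) ℂ}

/-- Changing one term of a series does not affect convergence, so every time line through t stays in
the domain. -/
theorem phase_update {t : ℕ → ℂ} (ht : t ∈ convergenceSet A) (j : ℕ) (s : ℂ) :
    Function.update t j s ∈ convergenceSet A ∧
      phase A (Function.update t j s) = phase A t + (s - t j) • A ^ (2 * j + 1) := by
  have h := ht.hasSum.update j (s • A ^ (2 * j + 1))
  have e : Function.update (fun i => t i • A ^ (2 * i + 1)) j (s • A ^ (2 * j + 1)) =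
      fun i => Function.update t j s i • A ^ (2 * i + 1) := by
    ext1 i
    rcases eq_or_ne i j with rfl | hij
    · simp
    · simp [Function.update_of_ne hij]
  rw [e] at h
  refine ⟨h.summable, ?_⟩
  rw [phase, h.tsum_eq, ← sub_smul, add_comm, phase]

theorem commute_phase (t : ℕ → ℂ) (ht : t ∈ convergenceSet A) (n : ℕ) :
    Commute (phase A t) (A ^ n) := by
  rw [Commute, SemiconjBy, phase, ← ht.tsum_mul_left, ← ht.tsum_mul_right]
  refine tsum_congr fun j => ?_
  rw [smul_mul_assoc, mul_smul_comm, ← pow_add, ← pow_add, add_comm]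

/-- `exp(c ∑ⱼ A^{2j+1} t_{2j+1}) C`. -/
noncomputable def flowVec (c : ℂ) (A : Matrix (Fin N) (Fin N) ℂ) (C : Fin N → ℂ) (t : ℕ → ℂ) :
    Fin N → ℂ :=
  NormedSpace.exp (c • phase A t) *ᵥ C

theorem phi_eq_flowVec (A : Matrix (Fin N) (Fin N) ℂ) (C : Fin N → ℂ) :
    phi A C = flowVec (1 / 2) A C := rfl

theorem psi_eq_flowVec (A : Matrix (Fin N) (Fin N) ℂ) (C : Fin N → ℂ) :
    psi A C = flowVec (-1 / 2) A C := by
  ext1 t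
  rw [psi, flowVec, ← neg_smul, neg_div]

theorem slice_flowVec (c : ℂ) (C : Fin N → ℂ) {t : ℕ → ℂ} (ht : t ∈ convergenceSet A) (j : ℕ)
    (s : ℂ) : slice (flowVec c A C) j t s =
      NormedSpace.exp ((c * (s - t j)) • A ^ (2 * j + 1)) *ᵥ flowVec c A C t := by
  rw [slice, flowVec, flowVec, (phase_update ht j s).2, smul_add, smul_smul, add_comm,
    Matrix.exp_add_of_commute, Matrix.mulVec_mulVec]
  exact ((commute_phase t ht _).smul_left c |>.smul_right _).symm

open scoped Matrix.Norms.Operator in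
theorem hasDerivAt_slice_flowVec (c : ℂ) (C : Fin N → ℂ) {t : ℕ → ℂ}
    (ht : t ∈ convergenceSet A) (j : ℕ) (s : ℂ) :
    HasDerivAt (slice (flowVec c A C) j t)
      (c • (A ^ (2 * j + 1) *ᵥ slice (flowVec c A C) j t s)) s := by
  have h1 : HasDerivAt (fun s => NormedSpace.exp ((c * (s - t j)) • A ^ (2 * j + 1)))
      (c • (A ^ (2 * j + 1) * NormedSpace.exp ((c * (s - t j)) • A ^ (2 * j + 1)))) s := by
    have h2 : HasDerivAt (fun s => c * (s - t j)) c s := by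
      simpa using ((hasDerivAt_id s).sub_const (t j)).const_mul c
    exact (hasDerivAt_exp_smul_const' (𝕂 := ℂ) (A ^ (2 * j + 1)) (c * (s - t j))).scomp s h2
  let L : Matrix (Fin N) (Fin N) ℂ →ₗ[ℂ] (Fin N → ℂ) :=
    (Matrix.mulVecBilin ℂ ℂ).flip (flowVec c A C t)
  have h3 := (LinearMap.toContinuousLinearMap L).hasFDerivAt.comp_hasDerivAt s h1
  have e : slice (flowVec c A C) j t = fun s =>
      L (NormedSpace.exp ((c * (s - t j)) • A ^ (2 * j + 1))) :=
    funext fun s => slice_flowVec c C ht j s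
  rw [e]
  refine h3.congr_deriv ?_
  change (c • (A ^ (2 * j + 1) * NormedSpace.exp ((c * (s - t j)) • A ^ (2 * j + 1)))) *ᵥ
    flowVec c A C t = c • (A ^ (2 * j + 1) *ᵥ
      (NormedSpace.exp ((c * (s - t j)) • A ^ (2 * j + 1)) *ᵥ flowVec c A C t))
  rw [Matrix.smul_mulVec, Matrix.mulVec_mulVec]

theorem xDeriv_flowVec (c : ℂ) (C : Fin N → ℂ) {t : ℕ → ℂ} (ht : t ∈ convergenceSet A) (k : ℕ) :
    xDeriv k (flowVec c A C) t = c ^ k • (A ^ k *ᵥ flowVec c A C t) := by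
  have h : iteratedDeriv k (slice (flowVec c A C) 0 t) =
      fun s => c ^ k • (A ^ k *ᵥ slice (flowVec c A C) 0 t s) := by
    induction k with
    | zero => ext1 s; simp
    | succ k ih =>
      ext1 s
      rw [iteratedDeriv_succ, ih]
      have h1 := (LinearMap.toContinuousLinearMap
        (Matrix.mulVecLin (A ^ k))).hasFDerivAt.comp_hasDerivAt s
          (hasDerivAt_slice_flowVec c C ht 0 s)
      refine (h1.const_smul (c ^ k)).deriv.trans ?_
      simp [Matrix.mulVec_mulVec, smul_smul, pow_succ]
  rw [xDeriv, h]
  simp only [slice, Function.update_eq_self]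

theorem doubleWronskian_eq_det_krylov (a : ℕ) (Cp Cm : Fin N → ℂ) {t : ℕ → ℂ}
    (ht : t ∈ convergenceSet A) :
    doubleWronskian a (phi A Cp) (psi A Cm) t = (krylov a A (phi A Cp t) (psi A Cm t)).det := by
  simp only [doubleWronskian, krylov, phi_eq_flowVec, psi_eq_flowVec, xDeriv_flowVec _ _ ht]

/-- Only odd powers of A occur, so conjugation by T negates the phase and inverts its exponential.
-/
theorem psi_eq_mulVec_phi {T : Matrix (Fin N) (Fin N) ℂ} (hAT : T * A = -A * T)
    (hT : T * T = 1) (Cp : Fin N → ℂ) {t : ℕ → ℂ} (ht : t ∈ convergenceSet A) :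
    psi A (T *ᵥ Cp) t = T *ᵥ phi A Cp t := by
  have hodd : ∀ j : ℕ, T * A ^ (2 * j + 1) = -(A ^ (2 * j + 1)) * T := by
    intro j
    have h : SemiconjBy T A (-A) := hAT
    have := h.pow_right (2 * j + 1)
    rwa [Odd.neg_pow ⟨j, rfl⟩] at this
  have hphase : T * phase A t = -phase A t * T := by
    rw [phase, ← ht.tsum_mul_left, neg_mul, ← ht.tsum_mul_right, ← tsum_neg]
    refine tsum_congr fun j => ?_
    rw [mul_smul_comm, hodd, smul_mul_assoc, neg_mul, smul_neg]
  have hinv : T⁻¹ = T := Matrix.inv_eq_left_inv hT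
  have hu : IsUnit T := ⟨⟨T, T, hT, hT⟩, rfl⟩
  have hexp := Matrix.exp_conj T ((1 / 2 : ℂ) • phase A t) hu
  rw [hinv, mul_smul_comm, hphase, smul_mul_assoc, mul_assoc, hT, mul_one, smul_neg] at hexp
  rw [psi, phi, hexp, Matrix.mulVec_mulVec, Matrix.mulVec_mulVec, mul_assoc, hT, mul_one]

end Flow

/-! ### The KdV hierarchy -/

section Solution

open PowerSeries

theorem trace_coeff_mul_comm (X Y : (Matrix (Fin 2) (Fin 2) ℂ)⟦X⟧) (k : ℕ) :
    (coeff k (X * Y)).trace = (coeff k (Y * X)).trace := by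
  rw [coeff_mul, coeff_mul, Matrix.trace_sum, Matrix.trace_sum,
    ← Finset.Nat.sum_antidiagonal_swap]
  exact Finset.sum_congr rfl fun p _ => Matrix.trace_mul_comm _ _

theorem trace_coeff_dress {W : (Matrix (Fin 2) (Fin 2) ℂ)⟦X⟧} (hW : constantCoeff W = 1) (k : ℕ) :
    coeff k (dress W pauli) 1 1 = -coeff k (dress W pauli) 0 0 := by
  have h : (coeff k (dress W pauli)).trace = 0 := by
    rw [dress, trace_coeff_mul_comm, ← mul_assoc, invOfUnit_mul W 1 (by simpa using hW), one_mul,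
      coeff_C]
    split_ifs
    · simp [pauli, Matrix.trace_fin_two]
    · simp
  rw [Matrix.trace_fin_two] at h
  linear_combination h

/-- A diagonal entry of a coefficient of R² = 1. The two end terms, with R₀ = σ₃, give the summand
linear in the new coefficient. -/
theorem dress_quadratic {W : (Matrix (Fin 2) (Fin 2) ℂ)⟦X⟧} (hW : constantCoeff W = 1) (n : ℕ) :
    2 * coeff (n + 2) (dress W pauli) 0 0 + ∑ i ∈ Finset.range (n + 1),
      (coeff (i + 1) (dress W pauli) 0 0 * coeff (n - i + 1) (dress W pauli) 0 0 +
        coeff (i + 1) (dress W pauli) 1 0 * coeff (n - i + 1) (dress W pauli) 0 1) = 0 := by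
  have h := congrArg (coeff (n + 2)) (dress_mul_self hW pauli_mul_self)
  rw [coeff_mul, Finset.Nat.sum_antidiagonal_eq_sum_range_succ_mk, Finset.sum_range_succ,
    Finset.sum_range_succ', coeff_one, if_neg (by omega)] at h
  replace h := congrFun (congrFun h 1) 1
  simp only [Nat.sub_zero, Nat.sub_self, coeff_zero_dress hW, Matrix.add_apply, Matrix.sum_apply,
    Matrix.mul_apply, Fin.sum_univ_two, trace_coeff_dress hW, Matrix.zero_apply] at h
  have e : ∀ i ∈ Finset.range (n + 1),
      (coeff (i + 1) (dress W pauli) 0 0 * coeff (n - i + 1) (dress W pauli) 0 0 +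
        coeff (i + 1) (dress W pauli) 1 0 * coeff (n - i + 1) (dress W pauli) 0 1) =
      coeff (i + 1) (dress W pauli) 1 0 * coeff (n + 2 - (i + 1)) (dress W pauli) 0 1 +
        -coeff (i + 1) (dress W pauli) 0 0 * -coeff (n + 2 - (i + 1)) (dress W pauli) 0 0 := by
    intro i hi
    have := Finset.mem_range.mp hi
    rw [show n + 2 - (i + 1) = n - i + 1 by omega]
    ring
  rw [Finset.sum_congr rfl e]
  simp [pauli] at h ⊢
  linear_combination h

variable {m : ℕ} {A : Matrix (Fin (2 * m + 3)) (Fin (2 * m + 3)) ℂ}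

theorem eventually_det_krylov_ne_zero {φ ψ : ℂ → Fin (2 * m + 3) → ℂ} {s : ℂ} (a : ℕ)
    (hφ : ContinuousAt φ s) (hψ : ContinuousAt ψ s) (h : (krylov a A (φ s) (ψ s)).det ≠ 0) :
    ∀ᶠ s in nhds s, (krylov a A (φ s) (ψ s)).det ≠ 0 := by
  have hF : Continuous fun p : (Fin (2 * m + 3) → ℂ) × (Fin (2 * m + 3) → ℂ) =>
      (krylov a A p.1 p.2).det := by
    refine Continuous.matrix_det (continuous_matrix fun i j => ?_)
    simp only [krylov, Matrix.of_apply, Pi.smul_apply, smul_eq_mul, Matrix.mulVec, dotProduct]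
    split_ifs <;> fun_prop
  exact (hF.continuousAt.comp (hφ.prodMk hψ)).eventually_ne h

open scoped Matrix.Norms.Operator in
/-- The resolvent of the dressing series evaluates the flows of the hierarchy with `q` constant. -/
theorem kdvK_eq_coeff_dress {U : Set ℂ} (hU : IsOpen U) {φ ψ : ℂ → Fin (2 * m + 3) → ℂ}
    (hφ : ∀ s ∈ U, HasDerivAt φ ((1 / 2 : ℂ) • (A *ᵥ φ s)) s)
    (hψ : ∀ s ∈ U, HasDerivAt ψ (-((1 / 2 : ℂ) • (A *ᵥ ψ s))) s)
    (hdet : ∀ s ∈ U, (krylov (m + 2) A (φ s) (ψ s)).det ≠ 0) {ε : ℂ} {r : ℂ → ℂ}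
    (hr : ∀ s ∈ U, r s = coeff 1 (dressing A (φ s) (ψ s)) 0 1)
    (hε : ∀ s ∈ U, coeff 1 (dressing A (φ s) (ψ s)) 1 0 = -ε) :
    (∀ s ∈ U, AnalyticAt ℂ r s) ∧ ∀ s ∈ U, ∀ l, kdvK ε l r s =
      -(coeff (2 * l + 2) (dress (dressing A (φ s) (ψ s)) pauli) 0 1 / 2) := by
  have hW : ∀ s ∈ U, HasCoeffDerivAt (fun s => dressing A (φ s) (ψ s))
      (-((1 / 2 : ℂ) • (tail 1 (dress (dressing A (φ s) (ψ s)) pauli) *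
        dressing A (φ s) (ψ s)))) s := by
    intro s hs
    refine hasCoeffDerivAt_dressing (n := 1) (by simpa using hφ s hs) (by simpa using hψ s hs) ?_
    filter_upwards [hU.mem_nhds hs] with y hy using hdet y hy
  have hr' : ∀ s ∈ U, AnalyticAt ℂ r s := by
    have hd : DifferentiableOn ℂ r U := fun s hs =>
      (((hW s hs).apply 1 0 1).congr_of_eventuallyEq (by
        filter_upwards [hU.mem_nhds hs] with y hy using hr y hy)).differentiableAt.differentiableWithinAt
    exact fun s hs => hd.analyticAt (hU.mem_nhds hs)
  refine ⟨hr', fun s hs l => ?_⟩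
  have hc1 := fun s => constantCoeff_dressing A (φ s) (ψ s)
  -- R₁ = [W₁, σ₃] has zero diagonal and doubles the off-diagonal entries of W₁ up to sign.
  have hone : ∀ s ∈ U, coeff 1 (dress (dressing A (φ s) (ψ s)) pauli) 0 0 = 0 ∧
      coeff 1 (dress (dressing A (φ s) (ψ s)) pauli) 0 1 = -2 * r s ∧
      coeff 1 (dress (dressing A (φ s) (ψ s)) pauli) 1 0 = -2 * ε := by
    intro s hs
    rw [coeff_one_dress (hc1 s), hr s hs]
    have := hε s hs
    refine ⟨?_, ?_, ?_⟩
    all_goals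
      simp only [Matrix.sub_apply, Matrix.mul_apply, Fin.sum_univ_two, this]
      simp [pauli]
    all_goals ring
  have hlax : ∀ s ∈ U, ∀ k i j, HasDerivAt
      (fun s => coeff k (dress (dressing A (φ s) (ψ s)) pauli) i j) _ s := fun s hs k i j =>
    hasDerivAt_pi.mp (hasDerivAt_pi.mp (hasDerivAt_coeff_dress pauli hc1 (hW s hs) k) i) j
  refine (evalAt_aknsK hU (q := fun _ => ε) (r := r)
    (a := fun k s => coeff k (dress (dressing A (φ s) (ψ s)) pauli) 0 0)
    (b := fun k s => coeff k (dress (dressing A (φ s) (ψ s)) pauli) 0 1)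
    (c := fun k s => coeff k (dress (dressing A (φ s) (ψ s)) pauli) 1 0)
    ?_ ?_ (fun s hs => (hone s hs).1) (fun s hs => (hone s hs).2.1) (fun s hs => (hone s hs).2.2)
    ?_ ?_ (fun s _ n => dress_quadratic (hc1 s) n) (2 * l + 1) hs).2.1
  · intro x _ k
    rw [iteratedDeriv_eq_iterate]
    exact (analyticAt_const.iterated_deriv k).differentiableAt
  · intro x hx k
    rw [iteratedDeriv_eq_iterate]
    exact ((hr' x hx).iterated_deriv k).differentiableAt
  · intro x hx k
    refine (hlax x hx k 0 1).congr_deriv ?_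
    obtain ⟨h1, h2, -⟩ := hone x hx
    simp only [Matrix.smul_apply, Matrix.add_apply, Matrix.sub_apply, Matrix.mul_apply,
      Fin.sum_univ_two, trace_coeff_dress (hc1 x), h1, h2]
    simp [pauli]
    ring
  · intro x hx k
    refine (hlax x hx k 1 0).congr_deriv ?_
    obtain ⟨h1, -, h3⟩ := hone x hx
    simp only [Matrix.smul_apply, Matrix.add_apply, Matrix.sub_apply, Matrix.mul_apply,
      Fin.sum_univ_two, trace_coeff_dress (hc1 x), h1, h3]
    simp [pauli]
    ring

open scoped Matrix.Norms.Operator in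
theorem solvesKdVHierarchyAt {T : Matrix (Fin (2 * m + 3)) (Fin (2 * m + 3)) ℂ}
    {Cp Cm : Fin (2 * m + 3) → ℂ} {t : ℕ → ℂ} (ht : t ∈ convergenceSet A)
    (hT : ∀ t ∈ convergenceSet A, doubleWronskian (m + 1) (phi A Cp) (psi A Cm) t =
      T.det * doubleWronskian (m + 2) (phi A Cp) (psi A Cm) t)
    (hf : doubleWronskian (m + 2) (phi A Cp) (psi A Cm) t ≠ 0) :
    SolvesKdVHierarchyAt T.det
      (fun t' => -(4 * doubleWronskian (m + 3) (phi A Cp) (psi A Cm) t' /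
        doubleWronskian (m + 2) (phi A Cp) (psi A Cm) t')) t := by
  set r : (ℕ → ℂ) → ℂ := fun t' => -(4 * doubleWronskian (m + 3) (phi A Cp) (psi A Cm) t' /
    doubleWronskian (m + 2) (phi A Cp) (psi A Cm) t') with hrdef
  have hφ : ∀ l s, HasDerivAt (slice (phi A Cp) l t)
      ((1 / 2 : ℂ) • (A ^ (2 * l + 1) *ᵥ slice (phi A Cp) l t s)) s :=
    fun l s => hasDerivAt_slice_flowVec (1 / 2) Cp ht l s
  have hψ : ∀ l s, HasDerivAt (slice (psi A Cm) l t)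
      (-((1 / 2 : ℂ) • (A ^ (2 * l + 1) *ᵥ slice (psi A Cm) l t s))) s := by
    intro l s
    rw [← neg_smul, ← neg_div, psi_eq_flowVec]
    exact hasDerivAt_slice_flowVec (-1 / 2) Cm ht l s
  have hdw : ∀ a l s, doubleWronskian a (phi A Cp) (psi A Cm) (Function.update t l s) =
      (krylov a A (slice (phi A Cp) l t s) (slice (psi A Cm) l t s)).det :=
    fun a l s => doubleWronskian_eq_det_krylov a Cp Cm (phase_update ht l s).1
  have hr : ∀ l s, (krylov (m + 2) A (slice (phi A Cp) l t s) (slice (psi A Cm) l t s)).det ≠ 0 →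
      slice r l t s =
        coeff 1 (dressing A (slice (phi A Cp) l t s) (slice (psi A Cm) l t s)) 0 1 := by
    intro l s hs
    rw [coeff_one_dressing_zero_one hs, ← hdw, ← hdw]
    rfl
  have hφt : ∀ l, slice (phi A Cp) l t (t l) = phi A Cp t := fun l => by
    rw [slice, Function.update_eq_self]
  have hψt : ∀ l, slice (psi A Cm) l t (t l) = psi A Cm t := fun l => by
    rw [slice, Function.update_eq_self]
  have hft : ∀ l, (krylov (m + 2) A (slice (phi A Cp) l t (t l))
      (slice (psi A Cm) l t (t l))).det ≠ 0 := by
    intro l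
    rwa [← hdw, Function.update_eq_self]
  -- The hierarchy involves all x-derivatives of r, so the resolvent is needed on an open part of
  -- the x-line, not only at t.
  let U : Set ℂ :=
    {s | (krylov (m + 2) A (slice (phi A Cp) 0 t s) (slice (psi A Cm) 0 t s)).det ≠ 0}
  have hU : IsOpen U := isOpen_iff_mem_nhds.mpr fun s hs =>
    eventually_det_krylov_ne_zero _ (hφ 0 s).continuousAt (hψ 0 s).continuousAt hs
  obtain ⟨hana, hK⟩ := kdvK_eq_coeff_dress hU (ε := T.det) (r := slice r 0 t)
    (fun s _ => by simpa using hφ 0 s) (fun s _ => by simpa using hψ 0 s) (fun s hs => hs)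
    (fun s hs => hr 0 s hs) (fun s hs => by
      rw [coeff_one_dressing_one_zero hs, ← hdw, ← hdw, hT _ (phase_update ht 0 s).1,
        mul_div_cancel_right₀]
      rwa [hdw])
  refine ⟨hana _ (hft 0), fun l => ?_⟩
  have hev := eventually_det_krylov_ne_zero (m + 2) (hφ l (t l)).continuousAt
    (hψ l (t l)).continuousAt (hft l)
  have h := ((hasCoeffDerivAt_dressing (hφ l (t l)) (hψ l (t l)) hev).apply 1 0 1)
  refine (h.congr_of_eventuallyEq (hev.mono fun s hs => hr l s hs)).congr_deriv ?_
  -- The first coefficient of Sato's equation with n = 2l + 1 gives r' = -½(R_{2l+2})₀₁, the value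
  -- already found for the right-hand side of the flow.
  rw [hK _ (hft 0) l, map_neg, coeff_smul, coeff_one_tail_mul (constantCoeff_dressing _ _ _)]
  simp only [hφt, hψt, Matrix.neg_apply, Matrix.smul_apply, smul_eq_mul]
  ring

end Solution

end AKNS

theorem theorem1 (m : ℕ) (A T : Matrix (Fin (2 * m + 3)) (Fin (2 * m + 3)) ℂ)
    (Cp Cm : Fin (2 * m + 3) → ℂ)
    (hAT : A * T + T * A = 0) (hT : T ^ 2 = 1) (hC : Cm = T *ᵥ Cp) :
    (T.det = 1 ∨ T.det = -1) ∧
    (∀ t ∈ AKNS.convergenceSet A, AKNS.psi A Cm t = T *ᵥ AKNS.phi A Cp t) ∧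
    (∀ t ∈ AKNS.convergenceSet A,
      AKNS.doubleWronskian (m + 1) (AKNS.phi A Cp) (AKNS.psi A Cm) t =
        T.det * AKNS.doubleWronskian (m + 2) (AKNS.phi A Cp) (AKNS.psi A Cm) t) ∧
    (∀ t ∈ AKNS.convergenceSet A,
      AKNS.doubleWronskian (m + 2) (AKNS.phi A Cp) (AKNS.psi A Cm) t ≠ 0 →
        AKNS.SolvesKdVHierarchyAt T.det
          (fun t' => -(4 * AKNS.doubleWronskian (m + 3) (AKNS.phi A Cp) (AKNS.psi A Cm) t' /
            AKNS.doubleWronskian (m + 2) (AKNS.phi A Cp) (AKNS.psi A Cm) t')) t) := by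
  have hAT' : T * A = -A * T := by
    rw [neg_mul]
    exact eq_neg_of_add_eq_zero_right hAT
  have hTT : T * T = 1 := by rw [← pow_two, hT]
  have hpsi : ∀ t ∈ AKNS.convergenceSet A, AKNS.psi A Cm t = T *ᵥ AKNS.phi A Cp t := by
    intro t ht
    rw [hC]
    exact AKNS.psi_eq_mulVec_phi hAT' hTT Cp ht
  have hdet : ∀ t ∈ AKNS.convergenceSet A,
      AKNS.doubleWronskian (m + 1) (AKNS.phi A Cp) (AKNS.psi A Cm) t =
        T.det * AKNS.doubleWronskian (m + 2) (AKNS.phi A Cp) (AKNS.psi A Cm) t := by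
    intro t ht
    rw [AKNS.doubleWronskian_eq_det_krylov _ _ _ ht, AKNS.doubleWronskian_eq_det_krylov _ _ _ ht]
    refine AKNS.det_krylov_of_intertwining hAT' (hpsi t ht).symm ?_
    rw [hpsi t ht, Matrix.mulVec_mulVec, hTT, Matrix.one_mulVec]
  refine ⟨?_, hpsi, hdet, fun t ht hf => AKNS.solvesKdVHierarchyAt ht hdet hf⟩
  refine sq_eq_one_iff.mp ?_
  rw [← Matrix.det_pow, hT, Matrix.det_one]
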